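/- Let $p \neq 2$ be a prime, $\mathbb{F}_q$ a finite field of characteristic $p$, $\mathbb{Z}_q = W(\mathbb{F}_q)$ its ring of Witt vectors, and $\mathbb{Q}_q = \mathrm{Frac}(\mathbb{Z}_q)$ the unramified extension of $\mathbb{Q}_p$ with residue field $\mathbb{F}_q$. Let $a_0,a_1,a_2,b_0,\dots,b_4 \in \mathbb{Z}_q$, and put $G = \sum_{i=0}^{2} a_i X^i Z^{2-i}$, $H = \sum_{i=0}^{4} b_i X^i Z^{4-i}$, $g(x) = G(x,1)$, $h(x) = H(x,1)$. Assume that the plane projective quartic $Y^4 + \overline{G}(X,Z)\,Y^2 + \overline{H}(X,Z) = 0$ over $\mathbb{F}_q$ obtained by reducing the coefficients modulo $p$ is smooth. Let $A = \mathbb{Q}_q[x,y]/(y^4+g(x)y^2+h(x))$ and let $$H^1_{dR} = \ker\bigl(d : \Omega^1_{A/\mathbb{Q}_q} \to \Omega^2_{A/\mathbb{Q}_q}\bigr) \big/ dA$$ be the first algebraic de Rham cohomology of the affine curve $y^4+g(x)y^2+h(x)=0$ over $\mathbb{Q}_q$. Then the forms listed below are closed, and their classes form a $\mathbb{Q}_q$-basis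 of $H^1_{dR}$: 1. if $b_4 = 0$ and $a_2 = 0$: $\{x^j y^i\,dx : 0 \le j \le 1,\ 1 \le i \le 3\}$, so the dimension is $6$; 2. if $b_4 = 0$ and $a_2 \ne 0$: $\{x^j y^i\,dx : 0 \le j \le 1,\ 1 \le i \le 3\} \cup \{x^2y^2\,dx,\ x^2y^3\,dx\}$, so the dimension is $8$; 3. if $b_4 \ne 0$ and $a_2^2 - 4b_4 = 0$: $\{x^j y^i\,dx : 0 \le j \le 1,\ 1 \le i \le 3\} \cup \{x^2y\,dx\}$, so the dimension is $7$; 4. if $b_4 \ne 0$ and $a_2^2 - 4b_4 \ne 0$: $\{x^j y^i\,dx : 0 \le j \le 2,\ 1 \le i \le 3\}$, so the dimension is $9$. -/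

import Mathlib

open scoped KaehlerDifferential
open Polynomial

/-! ### The de Rham complex of a commutative algebra in degrees 0, 1, 2, and its first cohomology -/

namespace DeRham

section Wedge

variable {A M : Type*} [CommRing A] [AddCommGroup M] [Module A M]

lemma mul_mem_exteriorPower_two (v w : M) :
    ExteriorAlgebra.ι A v * ExteriorAlgebra.ι A w ∈ ⋀[A]^2 M := by
  change _ ∈ LinearMap.range (ExteriorAlgebra.ι A (M := M)) ^ 2
  rw [pow_two]
  exact Submodule.mul_mem_mul ⟨v, rfl⟩ ⟨w, rfl⟩

/-- The wedge product `M × M → ⋀² M`. -/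
noncomputable def wedge : M →ₗ[A] M →ₗ[A] ⋀[A]^2 M :=
  LinearMap.mk₂ A
    (fun v w => ⟨ExteriorAlgebra.ι A v * ExteriorAlgebra.ι A w, mul_mem_exteriorPower_two v w⟩)
    (fun v v' w => Subtype.ext (by simp [add_mul]))
    (fun c v w => Subtype.ext (by simp))
    (fun v w w' => Subtype.ext (by simp [mul_add]))
    (fun c v w => Subtype.ext (by simp))

lemma wedge_self (v : M) : wedge (A := A) v v = 0 :=
  Subtype.ext (ExteriorAlgebra.ι_sq_zero v)

lemma wedge_add_swap (v w : M) : wedge (A := A) v w + wedge (A := A) w v = 0 :=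
  Subtype.ext (ExteriorAlgebra.ι_add_mul_swap v w)

end Wedge

variable (K A : Type*) [CommRing K] [CommRing A] [Algebra K A]

/-- `d : A → Ω¹`, the universal derivation as a `K`-linear map. -/
noncomputable def d₀ : A →ₗ[K] Ω[A⁄K] := (KaehlerDifferential.D K A).toLinearMap

/-- The `K`-linear map from the free `A`-module on the symbols `db`, `b ∈ A`, to `Ω² = ⋀² Ω¹`,
sending `a · db` to `da ∧ db`. -/
noncomputable def preD₁ : (A →₀ A) →ₗ[K] ⋀[A]^2 Ω[A⁄K] :=
  Finsupp.lsum K fun b : A =>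
    ((wedge (A := A)).flip (d₀ K A b)).restrictScalars K ∘ₗ d₀ K A

lemma preD₁_single (a b : A) :
    preD₁ K A (Finsupp.single b a) = wedge (A := A) (d₀ K A a) (d₀ K A b) := by
  simp [preD₁]

lemma preD₁_smul (c : A) (s : A →₀ A) :
    preD₁ K A (c • s) = c • preD₁ K A s +
      wedge (A := A) (d₀ K A c) (Finsupp.linearCombination A (KaehlerDifferential.D K A) s) := by
  induction s using Finsupp.induction_linear with
  | zero => simp
  | add s t hs ht => simp only [smul_add, map_add, hs, ht]; abel
  | single b a =>
    simp only [Finsupp.smul_single, preD₁_single, smul_eq_mul, Finsupp.linearCombination_single]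
    simp [d₀]

lemma preD₁_eq_zero {s : A →₀ A}
    (hs : Finsupp.linearCombination A (KaehlerDifferential.D K A) s = 0) : preD₁ K A s = 0 := by
  have hs' : s ∈ KaehlerDifferential.kerTotal K A := by
    rw [← KaehlerDifferential.kerTotal_eq]; exact hs
  clear hs
  induction hs' using Submodule.span_induction with
  | zero => simp
  | add s t _ _ hs ht => simp [hs, ht]
  | smul c s h hs =>
    have h0 : Finsupp.linearCombination A (KaehlerDifferential.D K A) s = 0 := by
      have h' : s ∈ KaehlerDifferential.kerTotal K A := h
      rw [← KaehlerDifferential.kerTotal_eq] at h'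
      exact h'
    rw [preD₁_smul, hs, h0]; simp
  | mem s h =>
    obtain (⟨⟨x, y⟩, rfl⟩ | ⟨⟨x, y⟩, rfl⟩) | ⟨x, rfl⟩ := h
    · simp [preD₁_single, d₀]
    · simp only [map_sub, map_add, preD₁_single]
      simpa [d₀] using wedge_add_swap (A := A) (d₀ K A x) (d₀ K A y)
    · simp [preD₁_single, d₀]

/-- The exterior derivative `d : Ω¹ → Ω²`, the `K`-linear map with `d(a db) = da ∧ db`. -/
noncomputable def d₁ : Ω[A⁄K] →ₗ[K] ⋀[A]^2 Ω[A⁄K] :=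
  ((KaehlerDifferential.kerTotal K A).restrictScalars K).liftQ (preD₁ K A)
      (fun s hs => preD₁_eq_zero K A (by
        have h : s ∈ KaehlerDifferential.kerTotal K A := hs
        rw [← KaehlerDifferential.kerTotal_eq] at h
        exact h)) ∘ₗ
    (Submodule.Quotient.restrictScalarsEquiv K (KaehlerDifferential.kerTotal K A)).symm.toLinearMap
      ∘ₗ (KaehlerDifferential.quotKerTotalEquiv K A).symm.toLinearMap.restrictScalars K

lemma d₁_smul_D (a b : A) :
    d₁ K A (a • d₀ K A b) = wedge (A := A) (d₀ K A a) (d₀ K A b) := by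
  have h : (KaehlerDifferential.quotKerTotalEquiv K A).symm (a • d₀ K A b) =
      (KaehlerDifferential.kerTotal K A).mkQ (Finsupp.single b a) := by
    rw [LinearEquiv.symm_apply_eq]
    simp [KaehlerDifferential.quotKerTotalEquiv, d₀]
  rw [← preD₁_single]
  simp only [d₁, LinearMap.comp_apply, LinearMap.restrictScalars_apply, LinearEquiv.coe_coe, h]
  rfl

lemma d₁_d₀ (a : A) : d₁ K A (d₀ K A a) = 0 := by
  have h := d₁_smul_D K A 1 a
  rw [one_smul] at h
  rw [h]
  simp [d₀]

/-- Closed 1-forms. -/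
noncomputable abbrev closedForms : Submodule K Ω[A⁄K] := LinearMap.ker (d₁ K A)

/-- Exact 1-forms, as a subspace of the closed 1-forms. -/
noncomputable abbrev exactForms : Submodule K (closedForms K A) :=
  LinearMap.range ((d₀ K A).codRestrict (closedForms K A) (d₁_d₀ K A))

/-- The first algebraic de Rham cohomology of `Spec A` over `K`: closed 1-forms modulo exact
1-forms. -/
abbrev H1 : Type _ := closedForms K A ⧸ exactForms K A

variable {K A}

/-- The 1-form `ω` is closed and its class in `H¹` is `c`. -/
def HasClass (ω : Ω[A⁄K]) (c : H1 K A) : Prop :=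
  ∃ h : ω ∈ closedForms K A, (exactForms K A).mkQ ⟨ω, h⟩ = c

/-- The 1-forms `ω i` are closed and their classes form a `K`-basis of `H¹`. -/
def ClassesFormBasis {ι : Type*} (ω : ι → Ω[A⁄K]) : Prop :=
  ∃ B : Module.Basis ι K (H1 K A), ∀ i, HasClass (ω i) (B i)

end DeRham

/-! ### The curves `Y⁴ + G(X, Z) Y² + H(X, Z) = 0` -/

namespace PlaneQuartic

section

variable {R : Type*} [CommRing R]

/-- The quartic form `Y⁴ + G(X, Z) Y² + H(X, Z)` in the variables `X, Y, Z = X₀, X₁, X₂`, with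
`G = ∑ aᵢ Xⁱ Z²⁻ⁱ` and `H = ∑ bᵢ Xⁱ Z⁴⁻ⁱ`. -/
noncomputable def form (a : Fin 3 → R) (b : Fin 5 → R) : MvPolynomial (Fin 3) R :=
  .X 1 ^ 4
    + (∑ i : Fin 3, .C (a i) * .X 0 ^ (i : ℕ) * .X 2 ^ (2 - (i : ℕ))) * .X 1 ^ 2
    + ∑ i : Fin 5, .C (b i) * .X 0 ^ (i : ℕ) * .X 2 ^ (4 - (i : ℕ))

/-- The polynomial `y⁴ + g(x) y² + h(x)`, an element of `R[x][y]`, with `g = ∑ aᵢ xⁱ` and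
`h = ∑ bᵢ xⁱ`. -/
noncomputable def affinePoly (a : Fin 3 → R) (b : Fin 5 → R) : R[X][X] :=
  X ^ 4 + C (∑ i : Fin 3, C (a i) * X ^ (i : ℕ)) * X ^ 2 + C (∑ i : Fin 5, C (b i) * X ^ (i : ℕ))

/-- The coordinate ring `R[x, y] / (y⁴ + g(x) y² + h(x))`. -/
abbrev CoordRing (a : Fin 3 → R) (b : Fin 5 → R) : Type _ := AdjoinRoot (affinePoly a b)

/-- The coordinate function `x`. -/
noncomputable def x (a : Fin 3 → R) (b : Fin 5 → R) : CoordRing a b :=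
  AdjoinRoot.of (affinePoly a b) X

/-- The coordinate function `y`. -/
noncomputable def y (a : Fin 3 → R) (b : Fin 5 → R) : CoordRing a b :=
  AdjoinRoot.root (affinePoly a b)

/-- The differential form `xʲ yⁱ dx` on the affine curve. -/
noncomputable def monomialForm (a : Fin 3 → R) (b : Fin 5 → R) (j i : ℕ) : Ω[CoordRing a b⁄R] :=
  (x a b ^ j * y a b ^ i) • KaehlerDifferential.D R (CoordRing a b) (x a b)

end

/-- The plane projective curve `F = 0` over the field `k` is smooth: over the algebraic closure of
`k`, the form `F` and its three partial derivatives have no common zero in the projective plane. -/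
def IsSmooth {k : Type*} [Field k] (F : MvPolynomial (Fin 3) k) : Prop :=
  ∀ P : Fin 3 → AlgebraicClosure k, P ≠ 0 → MvPolynomial.aeval P F = 0 →
    ∃ i, MvPolynomial.aeval P (MvPolynomial.pderiv i F) ≠ 0

end PlaneQuartic

/-- `ℤ_q`, the ring of integers of `ℚ_q`, for `q = #k`: the ring of Witt vectors of `k`. -/
abbrev Zq (p : ℕ) [Fact p.Prime] (k : Type*) [Field k] [CharP k p] : Type _ := WittVector p k

/-- `ℚ_q`, the unramified extension of `ℚ_p` with residue field `k`, `q = #k`. -/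
abbrev Qq (p : ℕ) [Fact p.Prime] (k : Type*) [Field k] [CharP k p] : Type _ :=
  FractionRing (Zq p k)

/-- Coefficientwise reduction modulo `p`, `ℤ_q → 𝔽_q`. -/
noncomputable def reduction {p : ℕ} [Fact p.Prime] {k : Type*} [Field k] [CharP k p] {n : ℕ}
    (c : Fin n → Zq p k) : Fin n → k := fun i => WittVector.constantCoeff (c i)

/-- Coefficientwise inclusion `ℤ_q → ℚ_q`. -/
noncomputable def generic {p : ℕ} [Fact p.Prime] {k : Type*} [Field k] [CharP k p] {n : ℕ}
    (c : Fin n → Zq p k) : Fin n → Qq p k := fun i => algebraMap (Zq p k) (Qq p k) (c i)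

/-- For a finite set `S` of pairs `(j, i)`: the forms `xʲ yⁱ dx`, `(j, i) ∈ S`, are a basis of the
first algebraic de Rham cohomology of the affine curve `y⁴ + g(x) y² + h(x) = 0` over `ℚ_q`. -/
def IsH1Basis {p : ℕ} [Fact p.Prime] {k : Type*} [Field k] [CharP k p]
    (a : Fin 3 → Zq p k) (b : Fin 5 → Zq p k) (S : Finset (ℕ × ℕ)) : Prop :=
  DeRham.ClassesFormBasis fun s : S =>
    PlaneQuartic.monomialForm (generic a) (generic b) s.1.1 s.1.2

/-- The dimension over `ℚ_q` of the first algebraic de Rham cohomology of the affine curve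
`y⁴ + g(x) y² + h(x) = 0` over `ℚ_q`. -/
noncomputable def dimH1 {p : ℕ} [Fact p.Prime] {k : Type*} [Field k] [CharP k p]
    (a : Fin 3 → Zq p k) (b : Fin 5 → Zq p k) : ℕ :=
  Module.finrank (Qq p k)
    (DeRham.H1 (Qq p k) (PlaneQuartic.CoordRing (generic a) (generic b)))

/-! Completing the square turns the equation into `(y² + γ)² = Q` with `γ = g/2` and `Q = (g² -
4h)/4`, so that `h = γ² - Q`. A double root of `h` or of `g² - 4h`, read as a binary quartic and so
including the point at infinity, gives a singular point of the plane quartic. Smoothness of the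
reduction therefore excludes double roots modulo `p`, and by Gauss's lemma `h` and `Q` are separable
over `ℚ_q` (`isCoprime_derivative_of_reduction`).

Let `F` be the equation. Separability makes `F_x` and `F_y` generate the unit ideal, hence `Ω¹` is
generated by one form `ω` with `dx = F_y ω`, `dy = -F_x ω`, and `df = (F_y f_x - F_x f_y) ω`. All
1-forms are then closed. Integrating in `y`, then in `x`, makes every form cohomologous to some `(u₁
y + u₂ y² + u₃ y³) dx`.

Such a form is exact if and only if `u₂` lies in the image of `evenOp Q` and `(u₁, u₃)` in the image
of `oddOp γ Q` (`exists_hamiltonian_eq`, `exists_oddOp_evenOp_eq`). The two parts are the parities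
under `y ↦ -y`. The even one belongs to the quotient curve `s² = Q`, `s = y² + γ`, where `d(2 w s³)
= (2 Q w' + 3 Q' w) s dx`.

What remains is linear algebra over `K[x]`: both operators are injective, and polynomials of small
degree are a complement of their images. This is read off leading coefficients. `evenOp` raises
degrees by `deg Q - 1`; `oddOp` has in each degree a 2 × 2 matrix of leading coefficients, whose
determinant is a nonzero integer times leading coefficients of `h`, `Q` or `γ`. The degrees of `h`
and `Q` distinguish the four cases, which correspond to the number of points at infinity. -/

section LeadingTerms

variable {K : Type*} [Field K]

/-! ### Degree bounds with a prescribed, possibly zero, top coefficient -/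

/-- `p` has degree at most `n`, and the coefficient of `Xⁿ` in `p` is `c`. -/
def HasLead (p : K[X]) (n : ℕ) (c : K) : Prop :=
  (∀ r, n < r → p.coeff r = 0) ∧ p.coeff n = c

namespace HasLead

variable {p q : K[X]} {m n : ℕ} {c c' : K}

lemma natDegree_le (hp : HasLead p n c) : p.natDegree ≤ n :=
  natDegree_le_iff_coeff_eq_zero.2 hp.1

lemma of_natDegree_le (h : p.natDegree ≤ n) : HasLead p n (p.coeff n) :=
  ⟨natDegree_le_iff_coeff_eq_zero.1 h, rfl⟩

lemma of_degree_lt (h : p.degree < (n + 1 : ℕ)) : HasLead p n (p.coeff n) :=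
  ⟨fun r hr => (degree_lt_iff_coeff_zero p (n + 1)).1 h r hr, rfl⟩

lemma degree_lt_of_eq_zero (hp : HasLead p n 0) : p.degree < n :=
  (degree_lt_iff_coeff_zero p n).2 fun r hr => by
    rcases hr.eq_or_lt with rfl | hr
    · exact hp.2
    · exact hp.1 r hr

lemma congr (hp : HasLead p n c) (h : c = c') : HasLead p n c' := h ▸ hp

lemma cast (hp : HasLead p m c) (hm : m = n) (h : c = c') : HasLead p n c' := hm ▸ h ▸ hp

lemma add (hp : HasLead p n c) (hq : HasLead q n c') : HasLead (p + q) n (c + c') :=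
  ⟨fun r hr => by simp [hp.1 r hr, hq.1 r hr], by simp [hp.2, hq.2]⟩

lemma sub (hp : HasLead p n c) (hq : HasLead q n c') : HasLead (p - q) n (c - c') :=
  ⟨fun r hr => by simp [hp.1 r hr, hq.1 r hr], by simp [hp.2, hq.2]⟩

lemma mul (hp : HasLead p m c) (hq : HasLead q n c') : HasLead (p * q) (m + n) (c * c') := by
  refine ⟨natDegree_le_iff_coeff_eq_zero.1
    (natDegree_mul_le.trans (add_le_add hp.natDegree_le hq.natDegree_le)), ?_⟩
  rw [coeff_mul_add_eq_of_natDegree_le hp.natDegree_le hq.natDegree_le, hp.2, hq.2]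

lemma C_mul (a : K) (hp : HasLead p n c) : HasLead (C a * p) n (a * c) :=
  ⟨fun r hr => by simp [hp.1 r hr], by simp [hp.2]⟩

lemma C_mul_X_pow (a : K) (n : ℕ) : HasLead (C a * X ^ n) n a :=
  ⟨fun r hr => by simp [coeff_X_pow, hr.ne'], by simp⟩

lemma zero (n : ℕ) : HasLead (0 : K[X]) n 0 := ⟨by simp, by simp⟩

lemma weaken (hp : HasLead p n c) : HasLead p (n + 1) 0 :=
  ⟨fun r hr => hp.1 r (by omega), hp.1 _ (by omega)⟩

lemma derivative (hp : HasLead p (n + 1) c) : HasLead (derivative p) n ((n + 1) * c) :=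
  ⟨fun r hr => by simp [coeff_derivative, hp.1 (r + 1) (by omega)],
    by rw [coeff_derivative, hp.2, mul_comm]⟩

/-- The degree lost by differentiation is charged to `p`, so no `n - 1` appears. For `n = 0` the
derivative vanishes, in agreement with the factor `n`. -/
lemma mul_derivative (hp : HasLead p (m + 1) c) (hq : HasLead q n c') :
    HasLead (p * Polynomial.derivative q) (n + m) (n * (c * c')) := by
  cases n with
  | zero =>
    have : q = C (q.coeff 0) := eq_C_of_natDegree_le_zero hq.natDegree_le
    rw [this]
    simpa using zero _
  | succ n =>
    have := hp.mul hq.derivative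
    rw [show m + 1 + n = n + 1 + m by ring] at this
    exact this.congr (by push_cast; ring)

end HasLead

/-! ### Linear maps with invertible leading matrices -/

variable {L : K[X] × K[X] →ₗ[K] K[X] × K[X]} {τ μ : ℕ} {A B C' E : ℕ → K}

lemma map_prod_eq_add (L : K[X] × K[X] →ₗ[K] K[X] × K[X]) (α β : K[X]) :
    L (α, β) = L (α, 0) + L (0, β) := by rw [← map_add]; simp

/-- If the leading matrix of `L` is invertible in every degree then no nonzero element of the image
has small degree. -/
lemma eq_zero_of_map_degree_lt
    (h₁ : ∀ n α a, HasLead α n a → HasLead (L (α, 0)).1 (n + τ) (A n * a) ∧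
      HasLead (L (α, 0)).2 (n + 1) (C' n * a))
    (h₂ : ∀ n β b, HasLead β n b → HasLead (L (0, β)).1 (n + μ + τ) (B n * b) ∧
      HasLead (L (0, β)).2 (n + μ + 1) (E n * b))
    (hA : ∀ n, A n ≠ 0) (hdet : ∀ n, A (n + μ) * E n - B n * C' (n + μ) ≠ 0)
    (α β : K[X]) (hu : (L (α, β)).1.degree < τ) (hv : (L (α, β)).2.degree < (1 + μ : ℕ)) :
    α = 0 ∧ β = 0 := by
  -- The bound on `β` is `deg β < N - μ`, without truncated subtraction: coefficient `N` of `α` and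
  -- coefficient `N - μ` of `β` reach the same output degrees.
  suffices H : ∀ N : ℕ, α.degree < N → (∀ m, N ≤ m + μ → β.coeff m = 0) → α = 0 ∧ β = 0 by
    refine H (α.natDegree + β.natDegree + μ + 1) ?_ fun m hm => ?_
    · exact degree_le_natDegree.trans_lt (by exact_mod_cast (by omega))
    · exact coeff_eq_zero_of_natDegree_lt (by omega)
  intro N
  induction N with
  | zero => exact fun hα hβ => ⟨by simpa using hα, by ext m; simpa using hβ m (Nat.zero_le _)⟩
  | succ N ih =>
    intro hα hβ
    have hα' := HasLead.of_degree_lt hα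
    have key : ∀ a b, a = α.coeff N → HasLead (L (α, β)).1 (N + τ) b → b = 0 := by
      rintro a b rfl h
      rw [← h.2]
      exact (degree_lt_iff_coeff_zero _ _).1 hu _ (by omega)
    rcases lt_or_ge N μ with hN | hN
    · have hβ0 : β = 0 := by
        ext m
        simpa using hβ m (by omega)
      subst hβ0
      have ha : α.coeff N = 0 := by
        have := key _ _ rfl (h₁ _ _ _ hα').1
        simpa [hA N] using this
      exact ih (by rw [ha] at hα'; exact hα'.degree_lt_of_eq_zero) fun m _ => by simp
    · obtain ⟨m, rfl⟩ := Nat.exists_eq_add_of_le' hN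
      have hβ' : HasLead β m (β.coeff m) := ⟨fun r hr => hβ r (by omega), rfl⟩
      rw [map_prod_eq_add] at hv key
      have e₁ := key _ _ rfl ((h₁ _ _ _ hα').1.add (h₂ _ _ _ hβ').1)
      have e₂ : C' (m + μ) * α.coeff (m + μ) + E m * β.coeff m = 0 := by
        have h := (h₁ _ _ _ hα').2.add (h₂ _ _ _ hβ').2
        rw [← h.2]
        exact (degree_lt_iff_coeff_zero _ _).1 hv _ (by omega)
      have ha : α.coeff (m + μ) = 0 := by
        refine (mul_eq_zero.1 ?_).resolve_left (hdet m)
        linear_combination E m * e₁ - B m * e₂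
      have hb : β.coeff m = 0 := by
        refine (mul_eq_zero.1 ?_).resolve_left (hdet m)
        linear_combination A (m + μ) * e₂ - C' (m + μ) * e₁
      refine ih (by rw [ha] at hα'; exact hα'.degree_lt_of_eq_zero) fun r hr => ?_
      rcases (show m ≤ r by omega).eq_or_lt with rfl | hr
      · exact hb
      · exact hβ'.1 r hr

/-- If the leading matrix of `L` is invertible in every degree then every pair is congruent to one
of small degree modulo the image. -/
lemma exists_sub_map_degree_lt
    (h₁ : ∀ n α a, HasLead α n a → HasLead (L (α, 0)).1 (n + τ) (A n * a) ∧
      HasLead (L (α, 0)).2 (n + 1) (C' n * a))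
    (h₂ : ∀ n β b, HasLead β n b → HasLead (L (0, β)).1 (n + μ + τ) (B n * b) ∧
      HasLead (L (0, β)).2 (n + μ + 1) (E n * b))
    (hA : ∀ n, A n ≠ 0) (hdet : ∀ n, A (n + μ) * E n - B n * C' (n + μ) ≠ 0)
    (u v : K[X]) :
    ∃ z, (u - (L z).1).degree < τ ∧ (v - (L z).2).degree < (1 + μ : ℕ) := by
  suffices H : ∀ N : ℕ, ∀ u v : K[X], u.degree < (N + τ : ℕ) → v.degree < (N + 1 : ℕ) →
      ∃ z, (u - (L z).1).degree < τ ∧ (v - (L z).2).degree < (1 + μ : ℕ) by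
    refine H (u.natDegree + v.natDegree + 1) u v ?_ ?_
    · exact degree_le_natDegree.trans_lt (by exact_mod_cast (by omega))
    · exact degree_le_natDegree.trans_lt (by exact_mod_cast (by omega))
  intro N
  induction N with
  | zero =>
    intro u v hu hv
    refine ⟨0, by simpa using hu, ?_⟩
    simpa using hv.trans_le (by exact_mod_cast (by omega))
  | succ N ih =>
    intro u v hu hv
    have hu' : HasLead u (N + τ) (u.coeff (N + τ)) :=
      .of_degree_lt (by rwa [show N + τ + 1 = N + 1 + τ by ring])
    have hv' := HasLead.of_degree_lt hv
    -- Below `μ` no `β` is available, so only the top term of `u` is removed. The term of `v` in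
    -- degree `N + 1 ≤ μ` is allowed in the remainder; it is set aside for the induction hypothesis
    -- and put back afterwards.
    rcases lt_or_ge N μ with hN | hN
    · obtain ⟨l₁, l₂⟩ := h₁ _ _ _ (HasLead.C_mul_X_pow (u.coeff (N + τ) / A N) N)
      set z₀ : K[X] × K[X] := (C (u.coeff (N + τ) / A N) * X ^ N, 0)
      set v₁ := v - (L z₀).2
      have hv₁ := (hv'.sub l₂)
      obtain ⟨z, hz₁, hz₂⟩ := ih (u - (L z₀).1) (v₁ - C (v₁.coeff (N + 1)) * X ^ (N + 1))
        ((hu'.sub l₁).congr (by have := hA N; field_simp; ring)).degree_lt_of_eq_zero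
        ((hv₁.sub (HasLead.C_mul_X_pow _ _)).congr
          (sub_eq_zero.2 hv₁.2.symm)).degree_lt_of_eq_zero
      refine ⟨z₀ + z, ?_, ?_⟩
      · simpa [sub_add_eq_sub_sub] using hz₁
      · have : v - (L (z₀ + z)).2 = (v₁ - C (v₁.coeff (N + 1)) * X ^ (N + 1) - (L z).2)
            + C (v₁.coeff (N + 1)) * X ^ (N + 1) := by
          simp only [v₁, map_add, Prod.snd_add]; ring
        rw [this]
        refine (degree_add_le _ _).trans_lt (max_lt hz₂ ?_)
        exact (degree_C_mul_X_pow_le _ _).trans_lt (by exact_mod_cast (by omega))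
    · obtain ⟨m, rfl⟩ := Nat.exists_eq_add_of_le' hN
      have hd := hdet m
      set Δ := A (m + μ) * E m - B m * C' (m + μ) with hΔ
      set s := u.coeff (m + μ + τ)
      set t := v.coeff (m + μ + 1)
      -- Cramer's rule for the leading system with right-hand side `(s, t)`.
      obtain ⟨l₁, l₂⟩ := h₁ _ _ _ (HasLead.C_mul_X_pow ((E m * s - B m * t) / Δ) (m + μ))
      obtain ⟨r₁, r₂⟩ := h₂ _ _ _ (HasLead.C_mul_X_pow ((A (m + μ) * t - C' (m + μ) * s) / Δ) m)
      set α₀ := C ((E m * s - B m * t) / Δ) * X ^ (m + μ)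
      set β₀ := C ((A (m + μ) * t - C' (m + μ) * s) / Δ) * X ^ m
      have e := map_prod_eq_add L α₀ β₀
      obtain ⟨z, hz₁, hz₂⟩ := ih (u - (L (α₀, β₀)).1) (v - (L (α₀, β₀)).2)
        (by
          rw [e]
          refine ((hu'.sub (l₁.add r₁)).congr ?_).degree_lt_of_eq_zero
          field_simp
          rw [hΔ]; ring)
        (by
          rw [e]
          refine ((hv'.sub (l₂.add r₂)).congr ?_).degree_lt_of_eq_zero
          field_simp
          rw [hΔ]; ring)
      refine ⟨(α₀, β₀) + z, ?_, ?_⟩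
      · simpa only [sub_add_eq_sub_sub, map_add, Prod.fst_add] using hz₁
      · simpa only [sub_add_eq_sub_sub, map_add, Prod.snd_add] using hz₂

/-! ### The operators whose images are the exact forms -/

/-- The operator `w ↦ 2 Q w' + 3 Q' w`. -/
noncomputable def evenOp (Q : K[X]) : K[X] →ₗ[K] K[X] where
  toFun w := 2 * Q * derivative w + 3 * derivative Q * w
  map_add' v w := by simp only [derivative_add]; ring
  map_smul' r w := by simp only [smul_eq_C_mul, derivative_C_mul, RingHom.id_apply]; ring

/-- The operator that describes the exact odd differentials `u y dx + v y³ dx` on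
`(y² + γ)² = Q`. -/
noncomputable def oddOp (γ Q : K[X]) : K[X] × K[X] →ₗ[K] K[X] × K[X] where
  toFun z :=
    (C 3 * (C (-4) * ((γ ^ 2 - Q) * derivative z.1) - C 5 * (derivative (γ ^ 2 - Q) * z.1) +
        (γ * derivative Q - C 2 * (derivative γ * Q)) * z.2),
      C (-4) * (γ * derivative z.1) - C 10 * (derivative γ * z.1) + C 4 * (Q * derivative z.2) +
        C 7 * (derivative Q * z.2))
  map_add' v w := by
    ext1 <;> simp only [Prod.fst_add, Prod.snd_add, derivative_add] <;> ring
  map_smul' r w := by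
    ext1 <;> simp only [Prod.smul_fst, Prod.smul_snd, smul_eq_C_mul, derivative_C_mul,
      RingHom.id_apply] <;> ring

lemma oddOp_left (γ Q α : K[X]) : oddOp γ Q (α, 0) =
    (C 3 * (C (-4) * ((γ ^ 2 - Q) * derivative α) - C 5 * (derivative (γ ^ 2 - Q) * α)),
      C (-4) * (γ * derivative α) - C 10 * (derivative γ * α)) := by
  simp [oddOp]

lemma oddOp_right (γ Q β : K[X]) : oddOp γ Q (0, β) =
    (C 3 * ((γ * derivative Q - C 2 * (derivative γ * Q)) * β),
      C 4 * (Q * derivative β) + C 7 * (derivative Q * β)) := by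
  simp [oddOp]

/-- The polynomials of degree `< e` are a complement of the image of `evenOp Q`, and `evenOp Q` is
injective. -/
def EvenComplement (Q : K[X]) (e : ℕ) : Prop :=
  (∀ w, (evenOp Q w).degree < e → w = 0) ∧ ∀ u, ∃ w, (u - evenOp Q w).degree < e

/-- The pairs of polynomials of degrees `< τ` and `< σ` are a complement of the image of
`oddOp γ Q`, and `oddOp γ Q` is injective. -/
def OddComplement (γ Q : K[X]) (τ σ : ℕ) : Prop :=
  (∀ z, (oddOp γ Q z).1.degree < τ → (oddOp γ Q z).2.degree < σ → z = 0) ∧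
    ∀ u v, ∃ z, (u - (oddOp γ Q z).1).degree < τ ∧ (v - (oddOp γ Q z).2).degree < σ

lemma OddComplement.of_lead {γ Q : K[X]}
    (h₁ : ∀ n α a, HasLead α n a → HasLead (oddOp γ Q (α, 0)).1 (n + τ) (A n * a) ∧
      HasLead (oddOp γ Q (α, 0)).2 (n + 1) (C' n * a))
    (h₂ : ∀ n β b, HasLead β n b → HasLead (oddOp γ Q (0, β)).1 (n + μ + τ) (B n * b) ∧
      HasLead (oddOp γ Q (0, β)).2 (n + μ + 1) (E n * b))
    (hA : ∀ n, A n ≠ 0) (hdet : ∀ n, A (n + μ) * E n - B n * C' (n + μ) ≠ 0) :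
    OddComplement γ Q τ (1 + μ) :=
  ⟨fun z hu hv => by
    obtain ⟨h, h'⟩ := eq_zero_of_map_degree_lt h₁ h₂ hA hdet z.1 z.2 hu hv
    exact Prod.ext h h', exists_sub_map_degree_lt h₁ h₂ hA hdet⟩

/-! ### Leading matrices according to the behaviour at infinity -/

variable [CharZero K]

lemma evenComplement_of_hasLead {Q : K[X]} {e : ℕ} {q : K} (hQ : HasLead Q (e + 1) q)
    (hq : q ≠ 0) : EvenComplement Q e := by
  -- The statements on pairs apply with `μ = 0` after adding multiplication by `X` as a dummy second
  -- coordinate, whose leading coefficient is always 1.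
  let L : K[X] × K[X] →ₗ[K] K[X] × K[X] :=
    (evenOp Q).prodMap (LinearMap.mulLeft K X)
  have h₁ : ∀ n α a, HasLead α n a →
      HasLead (L (α, 0)).1 (n + e) ((2 * n + 3 * (e + 1)) * q * a) ∧
      HasLead (L (α, 0)).2 (n + 1) (0 * a) := by
    intro n α a hα
    constructor
    · have := ((hQ.mul_derivative hα).C_mul 2).add
        (((hQ.derivative.mul hα).cast (add_comm e n) rfl).C_mul 3)
      have h : (L (α, 0)).1 = C 2 * (Q * derivative α) + C 3 * (derivative Q * α) := by
        simp only [L, evenOp, LinearMap.prodMap_apply, LinearMap.coe_mk, AddHom.coe_mk, map_ofNat,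
          mul_assoc]
      rw [h]
      exact this.congr (by ring)
    · simpa [L] using HasLead.zero (n + 1)
  have h₂ : ∀ n β b, HasLead β n b →
      HasLead (L (0, β)).1 (n + 0 + e) (0 * b) ∧ HasLead (L (0, β)).2 (n + 0 + 1) (1 * b) := by
    intro n β b hβ
    constructor
    · simpa [L] using HasLead.zero (n + 0 + e)
    · have := (HasLead.C_mul_X_pow (1 : K) 1).mul hβ
      simpa [L, add_comm] using this
  have hA : ∀ n : ℕ, (2 * n + 3 * (e + 1)) * q ≠ 0 := fun n =>
    mul_ne_zero (by exact_mod_cast (by omega : 2 * n + 3 * (e + 1) ≠ 0)) hq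
  refine ⟨fun w hw => ?_, fun u => ?_⟩
  · exact (eq_zero_of_map_degree_lt (A := fun n => (2 * n + 3 * (e + 1)) * q) (B := fun _ => 0)
      (C' := fun _ => 0) (E := fun _ => 1) h₁ h₂ hA (by simpa using hA) w 0 hw (by simp [L])).1
  · obtain ⟨z, hz, -⟩ := exists_sub_map_degree_lt (A := fun n => (2 * n + 3 * (e + 1)) * q)
      (B := fun _ => 0) (C' := fun _ => 0) (E := fun _ => 1) h₁ h₂ hA (by simpa using hA) u 0
    exact ⟨z.1, hz⟩

variable {γ Q : K[X]} {c q b : K}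

/-- Four points at infinity. -/
lemma oddComplement_of_quartic_quartic (hγ : HasLead γ 2 c) (hQ : HasLead Q 4 q)
    (hh : HasLead (γ ^ 2 - Q) 4 b) (hq : q ≠ 0) (hb : b ≠ 0) : OddComplement γ Q 3 3 := by
  refine OddComplement.of_lead (μ := 2) (A := fun n => -(12 * (n + 5)) * b)
    (B := fun _ => 0) (C' := fun n => -(4 * n + 20) * c) (E := fun n => (4 * n + 28) * q)
    ?_ ?_ ?_ ?_
  · intro n α a hα
    rw [oddOp_left]
    exact ⟨((((hh.mul_derivative hα).C_mul _).sub
        (((hh.derivative.mul hα).cast (add_comm _ _) rfl).C_mul _)).C_mul _).congr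
          (by push_cast; ring),
      (((hγ.mul_derivative hα).C_mul _).sub
        (((hγ.derivative.mul hα).cast (add_comm _ _) rfl).C_mul _)).congr (by push_cast; ring)⟩
  · intro n β b hβ
    rw [oddOp_right]
    -- The top terms of `γ Q' - 2 γ' Q` cancel, as `4 c q - 2 · 2 c q = 0`, so the leading matrix is
    -- triangular.
    exact ⟨((((hγ.mul hQ.derivative).sub ((hγ.derivative.mul hQ).C_mul _)).mul hβ).C_mul _).cast
        (by ring) (by push_cast; ring),
      (((hQ.mul_derivative hβ).C_mul _).add
        (((hQ.derivative.mul hβ).cast (add_comm _ _) rfl).C_mul _)).congr (by push_cast; ring)⟩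
  · intro n
    exact mul_ne_zero (neg_ne_zero.2 (by exact_mod_cast (by omega : 12 * (n + 5) ≠ 0))) hb
  · intro n
    have h : ((12 * (n + 7) * (4 * n + 28) : ℕ) : K) ≠ 0 := by
      exact_mod_cast (by positivity : 12 * (n + 7) * (4 * n + 28) ≠ 0)
    convert neg_ne_zero.2 (mul_ne_zero h (mul_ne_zero hb hq)) using 1
    push_cast; ring

/-- Two points at infinity. -/
lemma oddComplement_of_cubic_quartic (hγ : HasLead γ 2 c) (hQ : HasLead Q 3 q)
    (hh : HasLead (γ ^ 2 - Q) 4 (c ^ 2)) (hq : q ≠ 0) (hc : c ≠ 0) : OddComplement γ Q 3 2 := by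
  refine OddComplement.of_lead (μ := 1) (A := fun n => -(12 * (n + 5)) * c ^ 2)
    (B := fun _ => -3 * c * q) (C' := fun n => -(4 * n + 20) * c) (E := fun n => (4 * n + 21) * q)
    ?_ ?_ ?_ ?_
  · intro n α a hα
    rw [oddOp_left]
    exact ⟨((((hh.mul_derivative hα).C_mul _).sub
        (((hh.derivative.mul hα).cast (add_comm _ _) rfl).C_mul _)).C_mul _).congr
          (by push_cast; ring),
      (((hγ.mul_derivative hα).C_mul _).sub
        (((hγ.derivative.mul hα).cast (add_comm _ _) rfl).C_mul _)).congr (by push_cast; ring)⟩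
  · intro n β b hβ
    rw [oddOp_right]
    exact ⟨((((hγ.mul hQ.derivative).sub ((hγ.derivative.mul hQ).C_mul _)).mul hβ).C_mul _).cast
        (by ring) (by push_cast; ring),
      (((hQ.mul_derivative hβ).C_mul _).add
        (((hQ.derivative.mul hβ).cast (add_comm _ _) rfl).C_mul _)).congr (by push_cast; ring)⟩
  · intro n
    exact mul_ne_zero (neg_ne_zero.2 (by exact_mod_cast (by omega : 12 * (n + 5) ≠ 0)))
      (pow_ne_zero 2 hc)
  · intro n
    -- Up to the factor `-c² q`, the determinant is `12 (n + 6)(4 n + 21) + 12 (n + 6)`.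
    have h : ((12 * (n + 6) * (4 * n + 22) : ℕ) : K) ≠ 0 := by
      exact_mod_cast (by positivity : 12 * (n + 6) * (4 * n + 22) ≠ 0)
    convert neg_ne_zero.2 (mul_ne_zero h (mul_ne_zero (pow_ne_zero 2 hc) hq)) using 1
    push_cast; ring

/-- Three points at infinity. -/
lemma oddComplement_of_quartic_cubic (hγ : HasLead γ 2 c) (hQ : HasLead Q 4 (c ^ 2))
    (hh : HasLead (γ ^ 2 - Q) 3 b) (hb : b ≠ 0) (hc : c ≠ 0) : OddComplement γ Q 2 3 := by
  refine OddComplement.of_lead (μ := 2) (A := fun n => -(3 * (4 * n + 15)) * b)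
    (B := fun _ => 3 * c * b) (C' := fun n => -(4 * n + 20) * c)
    (E := fun n => (4 * n + 28) * c ^ 2) ?_ ?_ ?_ ?_
  · intro n α a hα
    rw [oddOp_left]
    exact ⟨((((hh.mul_derivative hα).C_mul _).sub
        (((hh.derivative.mul hα).cast (add_comm _ _) rfl).C_mul _)).C_mul _).congr
          (by push_cast; ring),
      (((hγ.mul_derivative hα).C_mul _).sub
        (((hγ.derivative.mul hα).cast (add_comm _ _) rfl).C_mul _)).congr (by push_cast; ring)⟩
  · intro n β b' hβ
    rw [oddOp_right]
    refine ⟨?_, (((hQ.mul_derivative hβ).C_mul _).add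
        (((hQ.derivative.mul hβ).cast (add_comm _ _) rfl).C_mul _)).congr (by push_cast; ring)⟩
    -- The degree 5 terms cancel and the coefficient in degree 4 is needed. In terms of the cubic
    -- `γ² - Q` no cancellation of degree is left: that coefficient is `2 · 2 c b - 3 c b = c b`.
    have e : γ * derivative Q - C 2 * (derivative γ * Q) =
        C 2 * (derivative γ * (γ ^ 2 - Q)) - γ * derivative (γ ^ 2 - Q) := by
      simp only [derivative_sub, derivative_sq, map_ofNat]
      ring
    rw [e]
    exact (((((hγ.derivative.mul hh).C_mul _).sub (hγ.mul hh.derivative)).mul hβ).C_mul _).cast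
        (by ring) (by push_cast; ring)
  · intro n
    exact mul_ne_zero (neg_ne_zero.2 (by exact_mod_cast (by omega : 3 * (4 * n + 15) ≠ 0))) hb
  · intro n
    have h : ((3 * (4 * n + 28) * (4 * n + 22) : ℕ) : K) ≠ 0 := by
      exact_mod_cast (by positivity : 3 * (4 * n + 28) * (4 * n + 22) ≠ 0)
    convert neg_ne_zero.2 (mul_ne_zero h (mul_ne_zero (pow_ne_zero 2 hc) hb)) using 1
    push_cast; ring

/-- One point at infinity. -/
lemma oddComplement_of_cubic_cubic (hγ : HasLead γ 1 c) (hQ : HasLead Q 3 q)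
    (hh : HasLead (γ ^ 2 - Q) 3 b) (hq : q ≠ 0) (hb : b ≠ 0) : OddComplement γ Q 2 2 := by
  refine OddComplement.of_lead (μ := 1) (A := fun n => -(3 * (4 * n + 15)) * b)
    (B := fun _ => 3 * c * q) (C' := fun n => 0)
    (E := fun n => (4 * n + 21) * q) ?_ ?_ ?_ ?_
  · intro n α a hα
    rw [oddOp_left]
    exact ⟨((((hh.mul_derivative hα).C_mul _).sub
        (((hh.derivative.mul hα).cast (add_comm _ _) rfl).C_mul _)).C_mul _).congr
          (by push_cast; ring),
      -- Here `γ` counts as a quadratic with top coefficient 0, which makes the leading matrix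
      -- triangular whether or not `c` vanishes.
      (((hγ.weaken.mul_derivative hα).C_mul _).sub
        (((hγ.weaken.derivative.mul hα).cast (add_comm _ _) rfl).C_mul _)).congr
          (by push_cast; ring)⟩
  · intro n β b hβ
    rw [oddOp_right]
    exact ⟨((((hγ.mul hQ.derivative).sub
        (((HasLead.derivative (n := 0) hγ).mul hQ).C_mul _)).mul hβ).C_mul _).cast
        (by ring) (by push_cast; ring),
      (((hQ.mul_derivative hβ).C_mul _).add
        (((hQ.derivative.mul hβ).cast (add_comm _ _) rfl).C_mul _)).congr (by push_cast; ring)⟩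
  · intro n
    exact mul_ne_zero (neg_ne_zero.2 (by exact_mod_cast (by omega : 3 * (4 * n + 15) ≠ 0))) hb
  · intro n
    have h : ((3 * (4 * n + 19) * (4 * n + 21) : ℕ) : K) ≠ 0 := by
      exact_mod_cast (by positivity : 3 * (4 * n + 19) * (4 * n + 21) ≠ 0)
    convert neg_ne_zero.2 (mul_ne_zero h (mul_ne_zero hb hq)) using 1
    push_cast; ring

end LeadingTerms

lemma exists_derivative_eq {K : Type*} [Field K] [CharZero K] (u : K[X]) :
    ∃ P : K[X], derivative P = u := by
  induction u using Polynomial.induction_on' with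
  | add p q hp hq =>
    obtain ⟨P, rfl⟩ := hp
    obtain ⟨R, rfl⟩ := hq
    exact ⟨P + R, derivative_add⟩
  | monomial n a =>
    refine ⟨monomial (n + 1) (a / (n + 1)), ?_⟩
    have : (n : K) + 1 ≠ 0 := by exact_mod_cast n.succ_ne_zero
    rw [derivative_monomial]
    simp only [Nat.cast_add, Nat.cast_one, add_tsub_cancel_right]
    rw [div_mul_cancel₀ _ this]

/-! ### The coordinate ring of `(y² + γ)² = Q` and its Hamiltonian derivation -/

section Quartic

variable {K : Type*} [Field K]

/-- The polynomial `(y² + γ)² - Q`, in the form `y⁴ + 2 γ y² + (γ² - Q)`. -/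
noncomputable def quarticPoly (γ Q : K[X]) : K[X][X] :=
  X ^ 4 + C (2 * γ) * X ^ 2 + C (γ ^ 2 - Q)

lemma quarticPoly_natDegree (γ Q : K[X]) : (quarticPoly γ Q).natDegree = 4 := by
  unfold quarticPoly
  compute_degree!

lemma quarticPoly_monic (γ Q : K[X]) : (quarticPoly γ Q).Monic := by
  unfold quarticPoly
  monicity!

/-- The coordinate ring of `(y² + γ)² = Q`. -/
abbrev QuarticRing (γ Q : K[X]) : Type _ := AdjoinRoot (quarticPoly γ Q)

namespace QuarticRing

variable (γ Q : K[X])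

/-- The inclusion of `K[x]`. -/
noncomputable abbrev ι : K[X] →+* QuarticRing γ Q := AdjoinRoot.of (quarticPoly γ Q)

/-- The coordinate function `y`. -/
noncomputable abbrev y : QuarticRing γ Q := AdjoinRoot.root (quarticPoly γ Q)

/-- The partial derivative with respect to `x` of the equation. -/
noncomputable def Fx : QuarticRing γ Q :=
  2 * ι γ Q (derivative γ) * (y γ Q ^ 2 + ι γ Q γ) - ι γ Q (derivative Q)

/-- The partial derivative with respect to `y` of the equation. -/
noncomputable def Fy : QuarticRing γ Q := 4 * y γ Q * (y γ Q ^ 2 + ι γ Q γ)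

/-- The function with coordinates `c₀, …, c₃` with respect to `1, y, y², y³`. -/
noncomputable def comb (c₀ c₁ c₂ c₃ : K[X]) : QuarticRing γ Q :=
  ι γ Q c₀ + ι γ Q c₁ * y γ Q + ι γ Q c₂ * y γ Q ^ 2 + ι γ Q c₃ * y γ Q ^ 3

lemma ι_Q : ι γ Q Q = (y γ Q ^ 2 + ι γ Q γ) ^ 2 := by
  have h : AdjoinRoot.mk (quarticPoly γ Q) (X ^ 4 + C (2 * γ) * X ^ 2 + C (γ ^ 2 - Q)) = 0 :=
    AdjoinRoot.mk_self
  simp only [map_add, map_mul, map_sub, map_pow, AdjoinRoot.mk_C, AdjoinRoot.mk_X,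
    map_ofNat] at h
  linear_combination -h

lemma comb_eq_mk (c₀ c₁ c₂ c₃ : K[X]) : comb γ Q c₀ c₁ c₂ c₃ =
    AdjoinRoot.mk (quarticPoly γ Q) (C c₀ + C c₁ * X + C c₂ * X ^ 2 + C c₃ * X ^ 3) := by
  simp [comb]

lemma exists_comb (c : QuarticRing γ Q) : ∃ c₀ c₁ c₂ c₃, c = comb γ Q c₀ c₁ c₂ c₃ := by
  obtain ⟨f, rfl⟩ := AdjoinRoot.mk_surjective c
  set r := f %ₘ quarticPoly γ Q with hr
  have hdeg : r.natDegree < 4 := by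
    rw [← quarticPoly_natDegree γ Q]
    exact natDegree_modByMonic_lt _ (quarticPoly_monic γ Q) fun h => by
      have := quarticPoly_natDegree γ Q
      simp [h] at this
  refine ⟨r.coeff 0, r.coeff 1, r.coeff 2, r.coeff 3, ?_⟩
  have h : AdjoinRoot.mk (quarticPoly γ Q) f = AdjoinRoot.mk (quarticPoly γ Q) r := by
    rw [AdjoinRoot.mk_eq_mk]
    exact ⟨f /ₘ quarticPoly γ Q, by
      linear_combination -(modByMonic_add_div f (quarticPoly γ Q))⟩
  rw [h, comb_eq_mk]
  conv_lhs => rw [r.as_sum_range_C_mul_X_pow' hdeg]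
  simp [Finset.sum_range_succ]

variable {γ Q} in
lemma comb_eq_zero {c₀ c₁ c₂ c₃ : K[X]} (h : comb γ Q c₀ c₁ c₂ c₃ = 0) :
    c₀ = 0 ∧ c₁ = 0 ∧ c₂ = 0 ∧ c₃ = 0 := by
  rw [comb_eq_mk, AdjoinRoot.mk_eq_zero] at h
  have h0 : C c₀ + C c₁ * X + C c₂ * X ^ 2 + C c₃ * X ^ 3 = 0 := by
    by_contra hne
    refine (quarticPoly_monic γ Q).not_dvd_of_natDegree_lt hne ?_ h
    rw [quarticPoly_natDegree]
    refine lt_of_le_of_lt (b := 3) ?_ (by norm_num)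
    compute_degree
  refine ⟨?_, ?_, ?_, ?_⟩
  · simpa using congrArg (coeff · 0) h0
  · simpa [coeff_X, coeff_C] using congrArg (coeff · 1) h0
  · simpa [coeff_X, coeff_C] using congrArg (coeff · 2) h0
  · simpa [coeff_X, coeff_C] using congrArg (coeff · 3) h0

lemma aeval_x (p : K[X]) : aeval (ι γ Q X) p = ι γ Q p := by
  have := aeval_algebraMap_apply (QuarticRing γ Q) (X : K[X]) p
  rwa [aeval_X_left_apply] at this

section Derivation

variable {M : Type*} [AddCommGroup M] [Module K M] [Module (QuarticRing γ Q) M]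

variable {γ Q}

lemma derivation_ι (D : Derivation K (QuarticRing γ Q) M) (p : K[X]) :
    D (ι γ Q p) = ι γ Q (derivative p) • D (ι γ Q X) := by
  rw [← aeval_x, D.map_aeval, aeval_x]

lemma derivation_comb (D : Derivation K (QuarticRing γ Q) M) (c₀ c₁ c₂ c₃ : K[X]) :
    D (comb γ Q c₀ c₁ c₂ c₃) =
      comb γ Q (derivative c₀) (derivative c₁) (derivative c₂) (derivative c₃) • D (ι γ Q X) +
        (ι γ Q c₁ + 2 * ι γ Q c₂ * y γ Q + 3 * ι γ Q c₃ * y γ Q ^ 2) • D (y γ Q) := by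
  simp only [comb, map_add, Derivation.leibniz, Derivation.leibniz_pow, derivation_ι D c₀,
    derivation_ι D c₁, derivation_ι D c₂, derivation_ι D c₃]
  simp only [← Nat.cast_smul_eq_nsmul (QuarticRing γ Q)]
  push_cast
  module

lemma derivation_ext {D D' : Derivation K (QuarticRing γ Q) M}
    (hx : D (ι γ Q X) = D' (ι γ Q X)) (hy : D (y γ Q) = D' (y γ Q)) : D = D' := by
  ext c
  obtain ⟨c₀, c₁, c₂, c₃, rfl⟩ := exists_comb γ Q c
  rw [derivation_comb, derivation_comb, hx, hy]

lemma derivation_relation (D : Derivation K (QuarticRing γ Q) M) :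
    Fx γ Q • D (ι γ Q X) + Fy γ Q • D (y γ Q) = 0 := by
  have h := congrArg D (ι_Q γ Q)
  rw [derivation_ι, Derivation.leibniz_pow, map_add, Derivation.leibniz_pow, derivation_ι D γ] at h
  simp only [← Nat.cast_smul_eq_nsmul (QuarticRing γ Q)] at h
  push_cast at h
  rw [← sub_eq_zero] at h
  rw [← neg_eq_zero, ← h, Fx, Fy]
  module

end Derivation

/-- The derivation of `K[x, y]` that sends `f` to `F_y f_x - F_x f_y`. -/
noncomputable def hamiltonianPoly : Derivation K K[X][X] K[X][X] :=
  derivative (quarticPoly γ Q) • PolynomialModule.equivPolynomialSelf.compDer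
      (derivative' (R := K)).mapCoeffs -
    (C (2 * derivative γ) * X ^ 2 + C (derivative (γ ^ 2 - Q))) •
      (derivative' (R := K[X])).restrictScalars K

lemma equivPolynomialSelf_mapCoeffs_apply (f : K[X][X]) (n : ℕ) :
    (PolynomialModule.equivPolynomialSelf ((derivative' (R := K)).mapCoeffs f)).coeff n =
      derivative (f.coeff n) := rfl

lemma equivPolynomialSelf_mapCoeffs_C_mul_X_pow (p : K[X]) (n : ℕ) :
    PolynomialModule.equivPolynomialSelf ((derivative' (R := K)).mapCoeffs (C p * X ^ n)) =
      C (derivative p) * X ^ n := by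
  ext1 m
  rw [equivPolynomialSelf_mapCoeffs_apply]
  simp only [coeff_C_mul, coeff_X_pow]
  split_ifs <;> simp

lemma hamiltonianPoly_C_mul_X_pow (p : K[X]) (n : ℕ) : hamiltonianPoly γ Q (C p * X ^ n) =
    derivative (quarticPoly γ Q) * (C (derivative p) * X ^ n) -
      (C (2 * derivative γ) * X ^ 2 + C (derivative (γ ^ 2 - Q))) *
        derivative (C p * X ^ n) := by
  rw [← equivPolynomialSelf_mapCoeffs_C_mul_X_pow]
  rfl

lemma hamiltonianPoly_quarticPoly : hamiltonianPoly γ Q (quarticPoly γ Q) = 0 := by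
  -- The factors `C 1` and `X ^ 0` put each term in the monomial shape for which the derivation has
  -- been computed.
  have h : hamiltonianPoly γ Q (C 1 * X ^ 4 + C (2 * γ) * X ^ 2 + C (γ ^ 2 - Q) * X ^ 0) = 0 := by
    simp only [map_add, hamiltonianPoly_C_mul_X_pow]
    simp [quarticPoly]
    ring
  simpa [quarticPoly] using h

/-- The derivation kills the equation `F`, so it sends `F g` to `F` times the derivative of `g`. The
ideal `(F)` is stable and the derivation descends to the quotient. -/
lemma mk_hamiltonianPoly_eq_zero (f : K[X][X])
    (hf : (AdjoinRoot.mkₐ (quarticPoly γ Q)).restrictScalars K f = 0) :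
    (AdjoinRoot.mkₐ (quarticPoly γ Q)).restrictScalars K (hamiltonianPoly γ Q f) = 0 := by
  obtain ⟨g, rfl⟩ := AdjoinRoot.mk_eq_zero.1 hf
  refine AdjoinRoot.mk_eq_zero.2 ?_
  rw [Derivation.leibniz, hamiltonianPoly_quarticPoly, smul_zero, add_zero]
  exact Dvd.intro _ rfl

/-- The derivation of the coordinate ring that sends `f` to `F_y f_x - F_x f_y`. -/
noncomputable def hamiltonian : Derivation K (QuarticRing γ Q) (QuarticRing γ Q) :=
  Derivation.liftOfSurjective (f := (AdjoinRoot.mkₐ (quarticPoly γ Q)).restrictScalars K)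
    AdjoinRoot.mk_surjective (mk_hamiltonianPoly_eq_zero γ Q)

lemma hamiltonian_mk (f : K[X][X]) : hamiltonian γ Q (AdjoinRoot.mk _ f) =
    AdjoinRoot.mk _ (hamiltonianPoly γ Q f) :=
  Derivation.liftOfSurjective_apply
    (f := (AdjoinRoot.mkₐ (quarticPoly γ Q)).restrictScalars K) AdjoinRoot.mk_surjective
    (mk_hamiltonianPoly_eq_zero γ Q) f

lemma derivative_quarticPoly :
    derivative (quarticPoly γ Q) = 4 * X ^ 3 + C (2 * γ) * (2 * X) := by
  simp only [quarticPoly, derivative_add, derivative_mul, derivative_C, derivative_X_pow, zero_mul,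
    zero_add, add_zero, Nat.cast_ofNat, map_ofNat, Nat.add_one_sub_one, pow_one]

lemma hamiltonian_x : hamiltonian γ Q (ι γ Q X) = Fy γ Q := by
  have h := hamiltonian_mk γ Q (C X * X ^ 0)
  rw [hamiltonianPoly_C_mul_X_pow, derivative_quarticPoly] at h
  have e : ι γ Q X = AdjoinRoot.mk _ (C X * X ^ 0) := by simp
  rw [e, h, Fy]
  simp only [derivative_X, map_one, pow_zero, mul_one, derivative_C, mul_zero, sub_zero,
    map_add, map_mul, map_pow, map_ofNat, AdjoinRoot.mk_X, AdjoinRoot.mk_C]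
  ring

lemma hamiltonian_y : hamiltonian γ Q (y γ Q) = -Fx γ Q := by
  have h := hamiltonian_mk γ Q (C 1 * X ^ 1)
  rw [hamiltonianPoly_C_mul_X_pow] at h
  have e : y γ Q = AdjoinRoot.mk _ (C 1 * X ^ 1) := by simp
  rw [e, h, Fx]
  simp only [derivative_one, map_zero, map_one, one_mul, pow_one, zero_mul, mul_zero, zero_sub,
    derivative_X, mul_one, derivative_sq, map_neg, map_add, map_sub, map_mul,
    map_pow, map_ofNat, AdjoinRoot.mk_X, AdjoinRoot.mk_C]
  ring

end QuarticRing
end Quartic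

/-! ### Exact differentials -/

namespace QuarticRing

variable {K : Type*} [Field K] {γ Q : K[X]}

lemma map_C_ofNat (n : ℕ) [n.AtLeastTwo] :
    ι γ Q (C (OfNat.ofNat n : K)) = (OfNat.ofNat n : QuarticRing γ Q) := by
  rw [map_ofNat, map_ofNat]

/-- This is the Jacobian criterion. Modulo `y` one has `γ² - Q = 0` and `F_x = (γ² - Q)'`; modulo
`y² + γ` one has `Q = 0` and `F_x = -Q'`. By separability `F_x` is coprime to both factors of `F_y =
4 y (y² + γ)`. -/
lemma exists_mul_Fx_add_mul_Fy [CharZero K]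
    (hh : IsCoprime (γ ^ 2 - Q) (derivative (γ ^ 2 - Q))) (hQ : IsCoprime Q (derivative Q)) :
    ∃ a b, a * Fx γ Q + b * Fy γ Q = 1 := by
  have e := ι_Q γ Q
  have h₁ : IsCoprime (y γ Q) (Fx γ Q) := by
    obtain ⟨u, v, h⟩ := hh
    have h' := congrArg (ι γ Q) h
    simp only [derivative_sq, map_add, map_mul, map_sub, map_pow, map_ofNat, map_one, e] at h'
    refine ⟨-ι γ Q u * (y γ Q ^ 3 + 2 * ι γ Q γ * y γ Q) -
      2 * ι γ Q v * ι γ Q (derivative γ) * y γ Q, ι γ Q v, ?_⟩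
    rw [← h', Fx]
    ring
  have h₂ : IsCoprime (y γ Q ^ 2 + ι γ Q γ) (Fx γ Q) := by
    obtain ⟨u, v, h⟩ := hQ
    have h' := congrArg (ι γ Q) h
    simp only [map_add, map_mul, map_one, e] at h'
    refine ⟨ι γ Q u * (y γ Q ^ 2 + ι γ Q γ) + 2 * ι γ Q v * ι γ Q (derivative γ), -ι γ Q v, ?_⟩
    rw [← h', Fx]
    ring
  obtain ⟨b, a, h⟩ := h₁.mul_left h₂
  have h4 : ι γ Q (C (1 / 4)) * 4 = 1 := by
    rw [← map_C_ofNat (γ := γ) (Q := Q) 4, ← map_mul, ← C_mul]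
    norm_num
  refine ⟨a, ι γ Q (C (1 / 4)) * b, ?_⟩
  rw [Fy]
  linear_combination h + b * y γ Q * (y γ Q ^ 2 + ι γ Q γ) * h4

/-- `F_y` divides the nonzero polynomial `4 (γ² - Q) Q` of `K[x]`, and the coordinate ring is free
over `K[x]`. -/
lemma eq_zero_of_Fy_mul_eq_zero [CharZero K] (hh : γ ^ 2 - Q ≠ 0) (hQ : Q ≠ 0)
    {c : QuarticRing γ Q} (hc : Fy γ Q * c = 0) : c = 0 := by
  obtain ⟨c₀, c₁, c₂, c₃, rfl⟩ := exists_comb γ Q c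
  set c := comb γ Q c₀ c₁ c₂ c₃ with hdef
  set N : K[X] := C 4 * ((γ ^ 2 - Q) * Q)
  have hN : N ≠ 0 := mul_ne_zero (C_ne_zero.2 (by norm_num)) (mul_ne_zero hh hQ)
  have h : ι γ Q N * c = 0 := by
    have : ι γ Q N = -(y γ Q * (y γ Q ^ 2 + 2 * ι γ Q γ) * (y γ Q ^ 2 + ι γ Q γ)) * Fy γ Q := by
      simp only [N, map_mul, map_sub, map_pow, map_ofNat, ι_Q γ Q, Fy]
      ring
    rw [this, mul_assoc, hc, mul_zero]
  have h' : comb γ Q (N * c₀) (N * c₁) (N * c₂) (N * c₃) = 0 := by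
    rw [← h, hdef]
    simp only [comb, map_mul]
    ring
  obtain ⟨h₀, h₁, h₂, h₃⟩ := comb_eq_zero h'
  simp only [mul_eq_zero, hN, false_or] at h₀ h₁ h₂ h₃
  simp [hdef, h₀, h₁, h₂, h₃, comb]

/-- The image of `oddOp` and `evenOp` consists of exact differentials. -/
lemma exists_hamiltonian_eq [CharZero K] (z : K[X] × K[X]) (w : K[X]) :
    ∃ f, hamiltonian γ Q f =
      Fy γ Q * comb γ Q 0 (oddOp γ Q z).1 (evenOp Q w) (oddOp γ Q z).2 := by
  -- The coordinates of `f` are the ones forced in `exists_oddOp_evenOp_eq`; `P` cancels the part of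
  -- the differential that is a multiple of `dx` by a polynomial in `x`.
  obtain ⟨P, hP⟩ := exists_derivative_eq (w * (γ * derivative Q - 2 * derivative γ * Q))
  refine ⟨comb γ Q (-P) (C (-12) * (γ ^ 2 - Q) * z.1) (2 * Q * w)
    (C (-4) * γ * z.1 + C 4 * Q * z.2), ?_⟩
  rw [derivation_comb, hamiltonian_x, hamiltonian_y]
  simp only [comb, oddOp, evenOp, LinearMap.coe_mk, AddHom.coe_mk, hP, derivative_mul,
    derivative_sq, derivative_ofNat,
    map_add, map_sub, map_mul, map_neg, map_pow, map_ofNat, map_zero, ι_Q γ Q, smul_eq_mul, Fx, Fy]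
  ring

/-- Exact differentials come from `oddOp` and `evenOp`. -/
lemma exists_oddOp_evenOp_eq [CharZero K]
    (hh : IsCoprime (γ ^ 2 - Q) (derivative (γ ^ 2 - Q))) (hQ : IsCoprime Q (derivative Q))
    {f : QuarticRing γ Q} {u₁ u₂ u₃ : K[X]}
    (hf : hamiltonian γ Q f = Fy γ Q * comb γ Q 0 u₁ u₂ u₃) :
    ∃ z w, oddOp γ Q z = (u₁, u₃) ∧ evenOp Q w = u₂ := by
  obtain ⟨a, b, hab⟩ := exists_mul_Fx_add_mul_Fy hh hQ
  obtain ⟨f₀, f₁, f₂, f₃, rfl⟩ := exists_comb γ Q f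
  rw [derivation_comb, hamiltonian_x, hamiltonian_y, smul_eq_mul, smul_eq_mul] at hf
  set fx := comb γ Q (derivative f₀) (derivative f₁) (derivative f₂) (derivative f₃) with hfx
  set fy := ι γ Q f₁ + 2 * ι γ Q f₂ * y γ Q + 3 * ι γ Q f₃ * y γ Q ^ 2 with hfy
  set m := comb γ Q 0 u₁ u₂ u₃ with hm
  -- The hypothesis reads `F_y (f_x - m) = F_x f_y`. Since `F_x` is invertible modulo `F_y`, it
  -- follows that `F_y` divides `f_y`.
  obtain ⟨W, hW⟩ : ∃ W, fy = Fy γ Q * W :=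
    ⟨a * (fx - m) + b * fy, by linear_combination -fy * hab - a * hf⟩
  have hne {p : K[X]} (hp : IsCoprime p (derivative p)) : p ≠ 0 := by
    rintro rfl
    simp [IsCoprime] at hp
  have hWx : fx - m = Fx γ Q * W := by
    rw [← sub_eq_zero]
    refine eq_zero_of_Fy_mul_eq_zero (hne hh) (hne hQ) ?_
    linear_combination hf + Fx γ Q * hW
  obtain ⟨w₀, w₁, w₂, w₃, rfl⟩ := exists_comb γ Q W
  -- These are the coordinates of `f_y - F_y W`. As `f_y` has no `y³` term, the last one forces `w₀
  -- = γ w₂`; the others express `f₁, f₂, f₃` through `W`.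
  have e₁ : comb γ Q (f₁ + 4 * (γ ^ 2 - Q) * (w₁ - γ * w₃))
      (2 * f₂ - 4 * (γ * (w₀ - γ * w₂) + Q * w₂)) (3 * f₃ - 4 * (Q * w₃ - γ * (w₁ - γ * w₃)))
      (-4 * (w₀ - γ * w₂)) = 0 := by
    rw [← sub_eq_zero] at hW
    rw [← hW, hfy]
    simp only [comb, map_add, map_sub, map_mul, map_neg, map_pow, map_ofNat, ι_Q γ Q, Fy]
    ring
  obtain ⟨h₀, h₁, h₂, h₃⟩ := comb_eq_zero e₁
  have h₃' : w₀ = γ * w₂ := by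
    have : w₀ - γ * w₂ = 0 := by simpa using h₃
    linear_combination this
  subst h₃'
  -- The factors 3 in the parameters `α` and `β` allow the 3 in the equation for `3 f₃` to be
  -- cancelled.
  obtain ⟨α, hα⟩ : ∃ α, w₁ = γ * w₃ + 3 * α := by
    refine ⟨C (1 / 3) * (w₁ - γ * w₃), ?_⟩
    have : (3 : K[X]) * C (1 / 3) = 1 := by
      rw [← map_ofNat C 3, ← C_mul]; norm_num
    linear_combination (γ * w₃ - w₁) * this
  obtain ⟨β, rfl⟩ : ∃ β, w₃ = 3 * β := by
    refine ⟨C (1 / 3) * w₃, ?_⟩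
    have : (3 : K[X]) * C (1 / 3) = 1 := by
      rw [← map_ofNat C 3, ← C_mul]; norm_num
    linear_combination (- w₃) * this
  subst hα
  have h2 : (2 : K[X]) ≠ 0 := two_ne_zero
  have h3 : (3 : K[X]) ≠ 0 := OfNat.ofNat_ne_zero 3
  obtain rfl : f₁ = -12 * (γ ^ 2 - Q) * α := by linear_combination h₀
  obtain rfl : f₂ = 2 * Q * w₂ := mul_left_cancel₀ h2 (by linear_combination h₁)
  obtain rfl : f₃ = 4 * Q * β - 4 * γ * α := mul_left_cancel₀ h3 (by linear_combination h₂)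
  have e₂ : comb γ Q (derivative f₀ + w₂ * (γ * derivative Q - 2 * derivative γ * Q))
      ((oddOp γ Q (α, β)).1 - u₁) (evenOp Q w₂ - u₂) ((oddOp γ Q (α, β)).2 - u₃) = 0 := by
    rw [← sub_eq_zero] at hWx
    rw [← hWx, hfx, hm]
    simp only [comb, oddOp, evenOp, LinearMap.coe_mk, AddHom.coe_mk, derivative_mul, derivative_sq,
      derivative_ofNat, map_add, map_sub, map_mul, map_neg, map_pow, map_ofNat, map_zero, ι_Q γ Q,
      Fx]
    ring
  obtain ⟨-, h₁, h₂, h₃⟩ := comb_eq_zero e₂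
  exact ⟨(α, β), w₂, Prod.ext (sub_eq_zero.1 h₁) (sub_eq_zero.1 h₃), sub_eq_zero.1 h₂⟩

end QuarticRing

/-! ### Closedness of all 1-forms -/

namespace DeRham

variable {K A : Type*} [CommRing K] [CommRing A] [Algebra K A]

/-- If every differential of a function is a multiple of one form `ω` then all 1-forms are
closed. -/
lemma d₁_eq_zero_of_forall_eq_smul {ω : Ω[A⁄K]} {c : A → A} (h : ∀ a, d₀ K A a = c a • ω)
    (θ : Ω[A⁄K]) : d₁ K A θ = 0 := by
  obtain ⟨s, rfl⟩ := KaehlerDifferential.linearCombination_surjective K A θ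
  induction s using Finsupp.induction_linear with
  | zero => simp
  | add s t hs ht => rw [map_add, map_add, hs, ht, add_zero]
  | single b a =>
    rw [Finsupp.linearCombination_single]
    refine (d₁_smul_D K A a b).trans ?_
    rw [h a, h b]
    simp [wedge_self]

end DeRham

/-! ### Bases of a quotient from complements, and monomial vectors -/

section Basis

/-- A family whose span is a complement of the kernel of a surjection maps to a basis. -/
lemma exists_basis_of_isCompl_ker {K N H ι : Type*} [Field K] [AddCommGroup N] [Module K N]
    [AddCommGroup H] [Module K H] (ρ : N →ₗ[K] H) (hρ : Function.Surjective ρ) {m : ι → N}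
    (hm : LinearIndependent K m)
    (hc : IsCompl (LinearMap.ker ρ) (Submodule.span K (Set.range m))) :
    ∃ B : Module.Basis ι K H, ∀ i, B i = ρ (m i) := by
  refine ⟨(Module.Basis.span hm).map
    ((Submodule.quotientEquivOfIsCompl _ _ hc).symm.trans
      (ρ.quotKerEquivOfSurjective hρ)), fun i => ?_⟩
  rw [Module.Basis.map_apply, LinearEquiv.trans_apply]
  have : (Submodule.quotientEquivOfIsCompl _ _ hc).symm (Module.Basis.span hm i) =
      Submodule.Quotient.mk (m i) := by
    rw [LinearEquiv.symm_apply_eq]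
    have e : ((Module.Basis.span hm i : Submodule.span K (Set.range m)) : N) = m i := by
      rw [Module.Basis.span_apply]
    rw [← e, Submodule.quotientEquivOfIsCompl_apply_mk_right]
  rw [this]
  rfl

variable {K : Type*} [Field K]

/-- The vector `Xʲ` in the `i`-th of three coordinates, numbered from 1, for `s = (j, i)`. -/
noncomputable def monomialVector (s : ℕ × ℕ) : K[X] × K[X] × K[X] :=
  (if s.2 = 1 then X ^ s.1 else 0, if s.2 = 2 then X ^ s.1 else 0, if s.2 = 3 then X ^ s.1 else 0)

/-- The coefficient of `monomialVector s`. -/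
noncomputable def coeffVector (s : ℕ × ℕ) : K[X] × K[X] × K[X] →ₗ[K] K :=
  if s.2 = 1 then lcoeff K s.1 ∘ₗ LinearMap.fst K _ _
  else if s.2 = 2 then lcoeff K s.1 ∘ₗ LinearMap.fst K _ _ ∘ₗ LinearMap.snd K _ _
  else lcoeff K s.1 ∘ₗ LinearMap.snd K _ _ ∘ₗ LinearMap.snd K _ _

lemma linearIndependent_monomialVector {S : Finset (ℕ × ℕ)}
    (hS : ∀ s ∈ S, s.2 = 1 ∨ s.2 = 2 ∨ s.2 = 3) :
    LinearIndependent K fun s : S => (monomialVector s.1 : K[X] × K[X] × K[X]) := by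
  have key : ∀ s ∈ S, ∀ t ∈ S, coeffVector (K := K) s (monomialVector t) =
      if s = t then 1 else 0 := by
    rintro ⟨j, i⟩ hs ⟨j', i'⟩ ht
    have hi := hS _ hs
    have hi' := hS _ ht
    simp only at hi hi'
    rcases hi with rfl | rfl | rfl <;> rcases hi' with rfl | rfl | rfl <;>
      simp [coeffVector, monomialVector, coeff_X_pow]
  refine LinearIndependent.of_pairwise_dual_eq_zero_one _ (fun s : S => coeffVector s.1) ?_ ?_
  · intro s t hst
    simpa [Subtype.coe_inj, hst] using key s.1 s.2 t.1 t.2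
  · intro s
    simpa using key s.1 s.2 s.1 s.2

lemma span_monomialVector {S : Finset (ℕ × ℕ)} {τ e σ : ℕ}
    (hS : ∀ j i, (j, i) ∈ S ↔ i = 1 ∧ j < τ ∨ i = 2 ∧ j < e ∨ i = 3 ∧ j < σ) :
    Submodule.span K (Set.range fun s : S => (monomialVector s.1 : K[X] × K[X] × K[X])) =
      (degreeLT K τ).prod ((degreeLT K e).prod (degreeLT K σ)) := by
  classical
  have hX : ∀ {j n : ℕ}, j < n → (X ^ j : K[X]) ∈ degreeLT K n := fun h =>
    mem_degreeLT.2 ((degree_X_pow_le _).trans_lt (by exact_mod_cast h))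
  refine le_antisymm (Submodule.span_le.2 ?_) ?_
  · rintro _ ⟨⟨⟨j, i⟩, hs⟩, rfl⟩
    rcases (hS j i).1 hs with ⟨rfl, h⟩ | ⟨rfl, h⟩ | ⟨rfl, h⟩ <;>
      simpa [monomialVector] using hX h
  · set P := Submodule.span K
      (Set.range fun s : S => (monomialVector s.1 : K[X] × K[X] × K[X])) with hP
    have hmem : ∀ {j i : ℕ}, (j, i) ∈ S → (monomialVector (j, i) : K[X] × K[X] × K[X]) ∈ P :=
      fun h => Submodule.subset_span ⟨⟨_, h⟩, rfl⟩
    have key : ∀ (n : ℕ) (f : K[X] →ₗ[K] K[X] × K[X] × K[X]), (∀ j < n, f (X ^ j) ∈ P) →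
        ∀ u ∈ degreeLT K n, f u ∈ P := by
      intro n f hf
      change degreeLT K n ≤ P.comap f
      rw [degreeLT_eq_span_X_pow, Submodule.span_le]
      intro u hu
      simp only [Finset.coe_image, Set.mem_image, Finset.coe_range, Set.mem_Iio] at hu
      obtain ⟨j, hj, rfl⟩ := hu
      exact hf j hj
    rintro ⟨u, v, w⟩ ⟨hu, hv, hw⟩
    have h₁ := key τ (LinearMap.inl K _ _)
      (fun j hj => by
        simpa [monomialVector, Prod.mk_zero_zero] using hmem ((hS j 1).2 (by simp [hj]))) u hu
    have h₂ := key e (LinearMap.inr K _ _ ∘ₗ LinearMap.inl K _ _)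
      (fun j hj => by simpa [monomialVector] using hmem ((hS j 2).2 (by simp [hj]))) v hv
    have h₃ := key σ (LinearMap.inr K _ _ ∘ₗ LinearMap.inr K _ _)
      (fun j hj => by simpa [monomialVector] using hmem ((hS j 3).2 (by simp [hj]))) w hw
    simpa using add_mem (add_mem h₁ h₂) h₃

end Basis

/-! ### First cohomology as a quotient of `K[x]³` -/

namespace QuarticRing

open DeRham

variable {K : Type*} [Field K] {γ Q : K[X]}

/-- The differential of `x`. -/
noncomputable abbrev dx (γ Q : K[X]) : Ω[QuarticRing γ Q⁄K] :=
  KaehlerDifferential.D K (QuarticRing γ Q) (ι γ Q X)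

/-- With `a F_x + b F_y = 1`, the generator is `ω = b dx - a dy`: the relation `F_x dx + F_y dy = 0`
gives `F_y ω = dx` and `-F_x ω = dy`, and a derivation is determined by its values at `x` and `y`.
-/
lemma exists_D_eq_smul [CharZero K] (hh : IsCoprime (γ ^ 2 - Q) (derivative (γ ^ 2 - Q)))
    (hQ : IsCoprime Q (derivative Q)) : ∃ ω : Ω[QuarticRing γ Q⁄K],
      ∀ f, KaehlerDifferential.D K (QuarticRing γ Q) f = hamiltonian γ Q f • ω := by
  obtain ⟨a, b, hab⟩ := exists_mul_Fx_add_mul_Fy hh hQ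
  set dy := KaehlerDifferential.D K (QuarticRing γ Q) (y γ Q)
  have hrel : Fx γ Q • dx γ Q + Fy γ Q • dy = 0 :=
    derivation_relation (KaehlerDifferential.D K (QuarticRing γ Q))
  refine ⟨b • dx γ Q - a • dy, fun f => ?_⟩
  have h : KaehlerDifferential.D K (QuarticRing γ Q) =
      (LinearMap.toSpanSingleton _ _ (b • dx γ Q - a • dy)).compDer (hamiltonian γ Q) := by
    refine derivation_ext ?_ ?_
    · change dx γ Q = hamiltonian γ Q (ι γ Q X) • (b • dx γ Q - a • dy)
      rw [hamiltonian_x]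
      calc dx γ Q = (a * Fx γ Q + b * Fy γ Q) • dx γ Q := by rw [hab, one_smul]
        _ = Fy γ Q • (b • dx γ Q - a • dy) + a • (Fx γ Q • dx γ Q + Fy γ Q • dy) := by module
        _ = _ := by rw [hrel, smul_zero, add_zero]
    · change dy = hamiltonian γ Q (y γ Q) • (b • dx γ Q - a • dy)
      rw [hamiltonian_y]
      calc dy = (a * Fx γ Q + b * Fy γ Q) • dy := by rw [hab, one_smul]
        _ = -Fx γ Q • (b • dx γ Q - a • dy) + b • (Fx γ Q • dx γ Q + Fy γ Q • dy) := by module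
        _ = _ := by rw [hrel, smul_zero, add_zero]
  exact congrArg (fun D : Derivation K (QuarticRing γ Q) _ => D f) h

/-- The function `u₁ y + u₂ y² + u₃ y³`. -/
noncomputable def combLinear (γ Q : K[X]) : K[X] × K[X] × K[X] →ₗ[K] QuarticRing γ Q where
  toFun u := comb γ Q 0 u.1 u.2.1 u.2.2
  map_add' u v := by
    simp only [comb, Prod.fst_add, Prod.snd_add, map_add, map_zero]
    ring
  map_smul' r u := by
    have h (p : K[X]) : ι γ Q (r • p) = r • ι γ Q p :=
      (AdjoinRoot.smul_of (quarticPoly γ Q) r p).symm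
    simp only [comb, Prod.smul_fst, Prod.smul_snd, h, map_zero, smul_add, zero_add,
      smul_mul_assoc, RingHom.id_apply]

/-- The form `(u₁ y + u₂ y² + u₃ y³) dx`. -/
noncomputable def dxForm (γ Q : K[X]) : K[X] × K[X] × K[X] →ₗ[K] Ω[QuarticRing γ Q⁄K] :=
  (LinearMap.toSpanSingleton (QuarticRing γ Q) _ (dx γ Q)).restrictScalars K ∘ₗ combLinear γ Q

lemma dxForm_apply (u : K[X] × K[X] × K[X]) :
    dxForm γ Q u = comb γ Q 0 u.1 u.2.1 u.2.2 • dx γ Q := rfl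

/-- Modulo exact differentials, every differential is a multiple of `dx`. -/
lemma exists_eq_hamiltonian_add [CharZero K] (hh : IsCoprime (γ ^ 2 - Q) (derivative (γ ^ 2 - Q)))
    (hQ : IsCoprime Q (derivative Q)) (c : QuarticRing γ Q) :
    ∃ f u₁ u₂ u₃, c = hamiltonian γ Q f + Fy γ Q * comb γ Q 0 u₁ u₂ u₃ := by
  obtain ⟨a, b, hab⟩ := exists_mul_Fx_add_mul_Fy hh hQ
  obtain ⟨e₀, e₁, e₂, e₃, he⟩ := exists_comb γ Q (c * a)
  have hC (n : K) (hn : n ≠ 0) : ι γ Q (C (1 / n)) * ι γ Q (C n) = 1 := by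
    rw [← map_mul, ← C_mul, one_div_mul_cancel hn, C_1, map_one]
  have h2 := hC 2 two_ne_zero
  have h3 := hC 3 three_ne_zero
  have h4 := hC 4 (OfNat.ofNat_ne_zero 4)
  rw [map_C_ofNat] at h2 h3 h4
  -- `g` is a primitive of `c a` with respect to `y`; it involves `y⁴`, hence the extra summand.
  -- Adding its image under the Hamiltonian derivation to `c = c a F_x + c b F_y` removes the `F_x`
  -- term and leaves `F_y (r + c b)`.
  obtain ⟨g, hg⟩ : ∃ g, ∀ D : Derivation K (QuarticRing γ Q) (QuarticRing γ Q), ∃ r,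
      D g = r * D (ι γ Q X) + c * a * D (y γ Q) := by
    refine ⟨comb γ Q 0 e₀ (C (1 / 2) * e₁) (C (1 / 3) * e₂) +
      ι γ Q (C (1 / 4) * e₃) * y γ Q ^ 4, fun D =>
      ⟨comb γ Q 0 (derivative e₀) (C (1 / 2) * derivative e₁) (C (1 / 3) * derivative e₂) +
        ι γ Q (C (1 / 4) * derivative e₃) * y γ Q ^ 4, ?_⟩⟩
    rw [map_add, derivation_comb, Derivation.leibniz, Derivation.leibniz_pow,
      derivation_ι D (C (1 / 4) * e₃), he]
    simp only [derivative_C_mul, smul_eq_mul, nsmul_eq_mul, map_mul, comb, map_zero]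
    push_cast
    linear_combination (ι γ Q e₁ * y γ Q * D (y γ Q)) * h2 +
      (ι γ Q e₂ * y γ Q ^ 2 * D (y γ Q)) * h3 + (ι γ Q e₃ * y γ Q ^ 3 * D (y γ Q)) * h4
  obtain ⟨r, hr⟩ := hg (hamiltonian γ Q)
  obtain ⟨v₀, v₁, v₂, v₃, hv⟩ := exists_comb γ Q (r + c * b)
  -- The remaining part `v₀ dx` is the differential of a polynomial in `x`.
  obtain ⟨P, hP⟩ := exists_derivative_eq v₀
  refine ⟨ι γ Q P - g, v₁, v₂, v₃, ?_⟩
  rw [map_sub, hr, derivation_ι, hamiltonian_x, hamiltonian_y, hP, smul_eq_mul]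
  have : comb γ Q 0 v₁ v₂ v₃ = r + c * b - ι γ Q v₀ := by
    rw [hv]
    simp only [comb, map_zero]
    ring
  rw [this]
  linear_combination -c * hab

/-- Taking classes of `(u₁ y + u₂ y² + u₃ y³) dx` maps `K[x]³` onto the cohomology, with kernel the
image of `oddOp` and `evenOp`. The complement hypotheses say that the span of the chosen monomials
is a complement of this kernel. -/
theorem classesFormBasis_monomialVector [CharZero K]
    (hh : IsCoprime (γ ^ 2 - Q) (derivative (γ ^ 2 - Q))) (hQ : IsCoprime Q (derivative Q))
    {τ e σ : ℕ} (hodd : OddComplement γ Q τ σ) (heven : EvenComplement Q e)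
    {S : Finset (ℕ × ℕ)}
    (hS : ∀ j i, (j, i) ∈ S ↔ i = 1 ∧ j < τ ∨ i = 2 ∧ j < e ∨ i = 3 ∧ j < σ) :
    ClassesFormBasis fun s : S => dxForm γ Q (monomialVector s.1) := by
  obtain ⟨ω, hω⟩ := exists_D_eq_smul hh hQ
  have hclosed : ∀ θ, θ ∈ closedForms K (QuarticRing γ Q) := fun θ =>
    LinearMap.mem_ker.2 (d₁_eq_zero_of_forall_eq_smul hω θ)
  -- `φ` reads off the coefficient of a form along `ω`, so exactness of `θ` becomes an equation in
  -- the coordinate ring.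
  set φ := (hamiltonian γ Q).liftKaehlerDifferential with hφ
  have hφD : ∀ f, φ (KaehlerDifferential.D K _ f) = hamiltonian γ Q f :=
    (hamiltonian γ Q).liftKaehlerDifferential_comp_D
  have hφω : ∀ θ, φ θ • ω = θ := by
    intro θ
    have : (LinearMap.toSpanSingleton _ _ ω) ∘ₗ φ = LinearMap.id := by
      refine Derivation.liftKaehlerDifferential_unique _ _ ?_
      ext f
      change φ (KaehlerDifferential.D K _ f) • ω = KaehlerDifferential.D K _ f
      rw [hφD, hω]
    exact congrArg (fun l : Ω[QuarticRing γ Q⁄K] →ₗ[QuarticRing γ Q] _ => l θ) this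
  let cl : Ω[QuarticRing γ Q⁄K] →ₗ[K] H1 K (QuarticRing γ Q) :=
    (exactForms K _).mkQ ∘ₗ LinearMap.codRestrict _ LinearMap.id hclosed
  have hcl : ∀ θ, cl θ = 0 ↔ ∃ f, hamiltonian γ Q f = φ θ := by
    intro θ
    change (exactForms K _).mkQ ⟨θ, _⟩ = 0 ↔ _
    rw [Submodule.mkQ_apply, Submodule.Quotient.mk_eq_zero]
    constructor
    · rintro ⟨f, hf⟩
      have hf' : KaehlerDifferential.D K _ f = θ := congrArg Subtype.val hf
      exact ⟨f, by rw [← hφD, hf']⟩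
    · rintro ⟨f, hf⟩
      refine ⟨f, Subtype.ext ?_⟩
      change KaehlerDifferential.D K _ f = θ
      rw [hω, hf, hφω]
  have hcl_surj : Function.Surjective cl := by
    intro c
    obtain ⟨⟨θ, hθ⟩, rfl⟩ := Submodule.mkQ_surjective _ c
    exact ⟨θ, rfl⟩
  have hφdx : ∀ u, φ (dxForm γ Q u) = Fy γ Q * comb γ Q 0 u.1 u.2.1 u.2.2 := by
    intro u
    rw [dxForm_apply, map_smul, hφD, hamiltonian_x, smul_eq_mul, mul_comm]
  have hexact : ∀ u, cl (dxForm γ Q u) = 0 ↔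
      ∃ z w, oddOp γ Q z = (u.1, u.2.2) ∧ evenOp Q w = u.2.1 := by
    intro u
    rw [hcl, hφdx]
    constructor
    · rintro ⟨f, hf⟩
      exact exists_oddOp_evenOp_eq hh hQ hf
    · rintro ⟨z, w, hz, hw⟩
      obtain ⟨f, hf⟩ := exists_hamiltonian_eq (γ := γ) (Q := Q) z w
      exact ⟨f, by rw [hf, hz, hw]⟩
  have hsurj : Function.Surjective (cl ∘ₗ dxForm γ Q) := by
    intro c
    obtain ⟨θ, rfl⟩ := hcl_surj c
    obtain ⟨f, u₁, u₂, u₃, h⟩ := exists_eq_hamiltonian_add hh hQ (φ θ)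
    refine ⟨(u₁, u₂, u₃), ?_⟩
    rw [← sub_eq_zero, LinearMap.comp_apply, ← map_sub, hcl]
    exact ⟨-f, by rw [map_neg, map_sub, hφdx, h]; ring⟩
  obtain ⟨B, hB⟩ := exists_basis_of_isCompl_ker (cl ∘ₗ dxForm γ Q) hsurj
    (m := fun s : S => monomialVector s.1)
    (linearIndependent_monomialVector fun s hs => by
      rcases (hS s.1 s.2).1 hs with h | h | h <;> simp [h.1]) (by
    rw [span_monomialVector hS]
    constructor
    · rw [Submodule.disjoint_def]
      rintro ⟨u₁, u₂, u₃⟩ hu ⟨h₁, h₂, h₃⟩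
      obtain ⟨z, w, hz, hw⟩ := (hexact _).1 hu
      simp only at hz hw
      have hz0 := hodd.1 z (by rw [hz]; exact mem_degreeLT.1 h₁)
        (by rw [hz]; exact mem_degreeLT.1 h₃)
      have hw0 := heven.1 w (by rw [hw]; exact mem_degreeLT.1 h₂)
      rw [hz0, map_zero] at hz
      rw [hw0, map_zero] at hw
      rw [← hw, show u₁ = 0 from (congrArg Prod.fst hz).symm,
        show u₃ = 0 from (congrArg Prod.snd hz).symm]
      rfl
    · rw [codisjoint_iff, eq_top_iff]
      rintro ⟨u₁, u₂, u₃⟩ -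
      obtain ⟨z, h₁, h₃⟩ := hodd.2 u₁ u₃
      obtain ⟨w, h₂⟩ := heven.2 u₂
      refine Submodule.mem_sup.2 ⟨((oddOp γ Q z).1, evenOp Q w, (oddOp γ Q z).2),
        (hexact _).2 ⟨z, w, rfl, rfl⟩,
        (u₁ - (oddOp γ Q z).1, u₂ - evenOp Q w, u₃ - (oddOp γ Q z).2),
        ⟨mem_degreeLT.2 h₁, mem_degreeLT.2 h₂, mem_degreeLT.2 h₃⟩, by simp⟩)
  exact ⟨B, fun s => ⟨hclosed _, (hB s).symm⟩⟩

end QuarticRing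

/-! ### Separability from the reduction -/

section Gauss

variable {R : Type*} [CommRing R] [IsDomain R]

/-- Over the fraction field of a GCD domain every polynomial is divisible by
a primitive one of the same degree. -/
lemma exists_isPrimitive_map_dvd [NormalizedGCDMonoid R] {K : Type*} [Field K] [Algebra R K]
    [IsFractionRing R K] (d : K[X]) :
    ∃ d₀ : R[X], d₀.IsPrimitive ∧ d₀.natDegree = d.natDegree ∧
      d₀.map (algebraMap R K) ∣ d := by
  obtain ⟨b, hb, h⟩ := IsLocalization.integerNormalization_spec (nonZeroDivisors R) d
  set d₁ := IsLocalization.integerNormalization (nonZeroDivisors R) d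
  have hinj : Function.Injective (algebraMap R K) := IsFractionRing.injective R K
  have hb0 : algebraMap R K b ≠ 0 := by
    rw [Ne, map_eq_zero_iff _ hinj]
    exact nonZeroDivisors.ne_zero hb
  have h' : d₁.map (algebraMap R K) = C (algebraMap R K b) * d := by
    rw [h, ← smul_eq_C_mul, algebraMap_smul]
  refine ⟨d₁.primPart, d₁.isPrimitive_primPart, ?_, ?_⟩
  · rw [natDegree_primPart, ← natDegree_map_eq_of_injective hinj, h', natDegree_C_mul hb0]
  · have hdvd : d₁.primPart.map (algebraMap R K) ∣ C (algebraMap R K b) * d := by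
      rw [← h']
      exact Polynomial.map_dvd _ d₁.primPart_dvd
    exact ((isUnit_C.2 hb0.isUnit).dvd_mul_left).1 hdvd

/-- A polynomial of degree at most 4 over a unique factorization domain whose reduction has,
as a binary quartic form, no double root is separable over the fraction field. -/
lemma isCoprime_derivative_of_reduction [UniqueFactorizationMonoid R] {K : Type*} [Field K] [CharZero K] [Algebra R K]
    [IsFractionRing R K] {k : Type*} [Field k] (red : R →+* k) {f : R[X]}
    (hdeg : f.natDegree ≤ 4) (hinf : ¬ (red (f.coeff 4) = 0 ∧ red (f.coeff 3) = 0))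
    (hroot : ∀ x : AlgebraicClosure k,
      ¬ (aeval x (f.map red) = 0 ∧ aeval x (derivative (f.map red)) = 0)) :
    IsCoprime (f.map (algebraMap R K)) (derivative (f.map (algebraMap R K))) := by
  let _ : NormalizedGCDMonoid R := Classical.choice
    (inferInstance : Nonempty (NormalizedGCDMonoid R))
  have hinj : Function.Injective (algebraMap R K) := IsFractionRing.injective R K
  change Separable _
  rw [PerfectField.separable_iff_squarefree]
  intro d hd
  by_contra hdu
  have hf0 : f ≠ 0 := by
    rintro rfl
    simp at hinf
  have hfK : f.map (algebraMap R K) ≠ 0 := (Polynomial.map_ne_zero_iff hinj).2 hf0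
  have hd0 : d ≠ 0 := by
    rintro rfl
    exact hfK (by simpa using hd)
  obtain ⟨d₀, hprim, hdeg₀, hdvd⟩ := exists_isPrimitive_map_dvd (R := R) d
  have hpos : 0 < d₀.natDegree := by
    rw [hdeg₀, Nat.pos_iff_ne_zero]
    intro h
    exact hdu (isUnit_iff_degree_eq_zero.2 (by rw [degree_eq_natDegree hd0, h]; rfl))
  -- Gauss's lemma brings the square factor down to `R`, where it can be reduced.
  obtain ⟨r, hr⟩ : d₀ * d₀ ∣ f := by
    refine (hprim.mul hprim).dvd_of_fraction_map_dvd_fraction_map (K := K) ?_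
    rw [Polynomial.map_mul]
    exact (mul_dvd_mul hdvd hdvd).trans hd
  have hred : f.map red = d₀.map red * d₀.map red * r.map red := by
    rw [hr, Polynomial.map_mul, Polynomial.map_mul]
  -- If `d₀` reduces to a constant, its roots have moved to infinity: the reduction of `f` is then a
  -- constant times that of `r`, of degree at most 2, which is a double root at infinity. Otherwise
  -- a root of the reduced `d₀` is a finite double root.
  rcases Nat.eq_zero_or_pos (d₀.map red).natDegree with h0 | h0
  · have hr0 : r ≠ 0 := by
      rintro rfl
      exact hf0 (by rw [hr, mul_zero])
    have hd₀ : d₀ ≠ 0 := hprim.ne_zero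
    have hrdeg : r.natDegree ≤ 2 := by
      rw [hr, natDegree_mul (mul_ne_zero hd₀ hd₀) hr0, natDegree_mul hd₀ hd₀] at hdeg
      omega
    have hcoeff : ∀ i, 2 < i → red (f.coeff i) = 0 := by
      intro i hi
      have hri : r.coeff i = 0 := coeff_eq_zero_of_natDegree_lt (by omega)
      rw [← coeff_map, hred, eq_C_of_natDegree_eq_zero h0, ← C_mul, coeff_C_mul,
        coeff_map (n := i) (p := r), hri, map_zero, mul_zero]
    exact hinf ⟨hcoeff 4 (by norm_num), hcoeff 3 (by norm_num)⟩
  · obtain ⟨x, hx⟩ := IsAlgClosed.exists_aeval_eq_zero (AlgebraicClosure k) (d₀.map red)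
      (natDegree_pos_iff_degree_pos.1 h0).ne'
    refine hroot x ⟨?_, ?_⟩
    · rw [hred, map_mul, map_mul, hx]; ring
    · rw [hred, derivative_mul, derivative_mul]
      simp only [map_add, map_mul, hx]; ring

end Gauss

/-! ### The polynomials `g`, `h` and `g² - 4h` -/

namespace PlaneQuartic

section

variable {R : Type*} [CommRing R]

/-- The polynomial `g`. -/
noncomputable def gPoly (a : Fin 3 → R) : R[X] := C (a 2) * X ^ 2 + C (a 1) * X + C (a 0)

/-- The polynomial `h`. -/
noncomputable def hPoly (b : Fin 5 → R) : R[X] :=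
  C (b 4) * X ^ 4 + C (b 3) * X ^ 3 + C (b 2) * X ^ 2 + C (b 1) * X + C (b 0)

lemma affinePoly_eq (a : Fin 3 → R) (b : Fin 5 → R) :
    affinePoly a b = X ^ 4 + C (gPoly a) * X ^ 2 + C (hPoly b) := by
  have hg : ∑ i : Fin 3, C (a i) * X ^ (i : ℕ) = gPoly a := by
    simp [Fin.sum_univ_three, gPoly]
    ring
  have hh : ∑ i : Fin 5, C (b i) * X ^ (i : ℕ) = hPoly b := by
    simp [Fin.sum_univ_five, hPoly]
    ring
  rw [affinePoly, hg, hh]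

/-- The discriminant `g² - 4 h` with respect to `y²`. -/
noncomputable def discPoly (a : Fin 3 → R) (b : Fin 5 → R) : R[X] :=
  gPoly a ^ 2 - C 4 * hPoly b

lemma discPoly_eq (a : Fin 3 → R) (b : Fin 5 → R) : discPoly a b =
    C (a 2 ^ 2 - 4 * b 4) * X ^ 4 + C (2 * a 1 * a 2 - 4 * b 3) * X ^ 3 +
      C (a 1 ^ 2 + 2 * a 0 * a 2 - 4 * b 2) * X ^ 2 + C (2 * a 0 * a 1 - 4 * b 1) * X +
      C (a 0 ^ 2 - 4 * b 0) := by
  simp only [discPoly, gPoly, hPoly, map_add, map_sub, map_mul, map_pow, map_ofNat]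
  ring

lemma discPoly_coeff_four (a : Fin 3 → R) (b : Fin 5 → R) :
    (discPoly a b).coeff 4 = a 2 ^ 2 - 4 * b 4 := by
  have h (c₄ c₃ c₂ c₁ c₀ : R) :
      (C c₄ * X ^ 4 + C c₃ * X ^ 3 + C c₂ * X ^ 2 + C c₁ * X + C c₀).coeff 4 = c₄ := by simp
  rw [discPoly_eq, h]

lemma discPoly_coeff_three (a : Fin 3 → R) (b : Fin 5 → R) :
    (discPoly a b).coeff 3 = 2 * a 1 * a 2 - 4 * b 3 := by
  have h (c₄ c₃ c₂ c₁ c₀ : R) :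
      (C c₄ * X ^ 4 + C c₃ * X ^ 3 + C c₂ * X ^ 2 + C c₁ * X + C c₀).coeff 3 = c₃ := by simp
  rw [discPoly_eq, h]

variable {S : Type*} [CommRing S] (f : R →+* S)

lemma gPoly_map (a : Fin 3 → R) : (gPoly a).map f = gPoly (fun i => f (a i)) := by
  simp [gPoly]

lemma hPoly_map (b : Fin 5 → R) : (hPoly b).map f = hPoly (fun i => f (b i)) := by
  simp [hPoly]

lemma discPoly_map (a : Fin 3 → R) (b : Fin 5 → R) :
    (discPoly a b).map f = discPoly (fun i => f (a i)) (fun i => f (b i)) := by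
  rw [discPoly, discPoly, Polynomial.map_sub, Polynomial.map_mul, Polynomial.map_pow, gPoly_map,
    hPoly_map, map_C, map_ofNat f]

end

/-! ### Double roots give singular points -/

section Smooth

variable {k : Type*} [Field k] {a : Fin 3 → k} {b : Fin 5 → k}

/-- A smooth quartic has no singular point. -/
lemma IsSmooth.eq_zero (hC : IsSmooth (form a b)) {u v w : AlgebraicClosure k}
    {a' : Fin 3 → AlgebraicClosure k} {b' : Fin 5 → AlgebraicClosure k}
    (ha : ∀ i, a' i = algebraMap k _ (a i)) (hb : ∀ i, b' i = algebraMap k _ (b i))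
    (hF : v ^ 4 + (a' 0 * w ^ 2 + a' 1 * u * w + a' 2 * u ^ 2) * v ^ 2 +
      (b' 0 * w ^ 4 + b' 1 * u * w ^ 3 + b' 2 * u ^ 2 * w ^ 2 + b' 3 * u ^ 3 * w +
        b' 4 * u ^ 4) = 0)
    (hX : (a' 1 * w + 2 * a' 2 * u) * v ^ 2 +
      (b' 1 * w ^ 3 + 2 * b' 2 * u * w ^ 2 + 3 * b' 3 * u ^ 2 * w + 4 * b' 4 * u ^ 3) = 0)
    (hY : 4 * v ^ 3 + 2 * (a' 0 * w ^ 2 + a' 1 * u * w + a' 2 * u ^ 2) * v = 0)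
    (hZ : (2 * a' 0 * w + a' 1 * u) * v ^ 2 +
      (4 * b' 0 * w ^ 3 + 3 * b' 1 * u * w ^ 2 + 2 * b' 2 * u ^ 2 * w + b' 3 * u ^ 3) = 0) :
    u = 0 ∧ v = 0 ∧ w = 0 := by
  by_contra hne
  have hP : (![u, v, w] : Fin 3 → AlgebraicClosure k) ≠ 0 := by
    intro h
    exact hne ⟨congrFun h 0, congrFun h 1, congrFun h 2⟩
  obtain ⟨i, hi⟩ := hC ![u, v, w] hP (by
    rw [← hF]
    simp [form, Fin.sum_univ_three, Fin.sum_univ_five, ha, hb])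
  apply hi
  fin_cases i
  · rw [← hX]
    simp [form, Fin.sum_univ_three, Fin.sum_univ_five, ha, hb, MvPolynomial.pderiv_X]
    ring
  · rw [← hY]
    simp [form, Fin.sum_univ_three, Fin.sum_univ_five, ha, MvPolynomial.pderiv_X]
    ring
  · rw [← hZ]
    simp [form, Fin.sum_univ_three, Fin.sum_univ_five, ha, hb, MvPolynomial.pderiv_X]
    ring

lemma aeval_hPoly (x : AlgebraicClosure k) : aeval x (hPoly b) =
    algebraMap k _ (b 4) * x ^ 4 + algebraMap k _ (b 3) * x ^ 3 + algebraMap k _ (b 2) * x ^ 2 +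
      algebraMap k _ (b 1) * x + algebraMap k _ (b 0) := by
  simp [hPoly]

lemma aeval_derivative_hPoly (x : AlgebraicClosure k) : aeval x (derivative (hPoly b)) =
    4 * algebraMap k _ (b 4) * x ^ 3 + 3 * algebraMap k _ (b 3) * x ^ 2 +
      2 * algebraMap k _ (b 2) * x + algebraMap k _ (b 1) := by
  simp [hPoly, map_ofNat (algebraMap k (AlgebraicClosure k))]
  ring

lemma aeval_gPoly (x : AlgebraicClosure k) : aeval x (gPoly a) =
    algebraMap k _ (a 2) * x ^ 2 + algebraMap k _ (a 1) * x + algebraMap k _ (a 0) := by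
  simp [gPoly]

lemma aeval_derivative_gPoly (x : AlgebraicClosure k) : aeval x (derivative (gPoly a)) =
    2 * algebraMap k _ (a 2) * x + algebraMap k _ (a 1) := by
  simp [gPoly]
  ring

/-- The point `(x : 0 : 1)` would be singular. -/
lemma IsSmooth.hPoly_no_double_root (hC : IsSmooth (form a b)) (x : AlgebraicClosure k) :
    ¬ (aeval x (hPoly b) = 0 ∧ aeval x (derivative (hPoly b)) = 0) := by
  rintro ⟨h₁, h₂⟩
  rw [aeval_hPoly] at h₁
  rw [aeval_derivative_hPoly] at h₂
  have := hC.eq_zero (u := x) (v := 0) (w := 1) (fun _ => rfl) (fun _ => rfl)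
    (by linear_combination h₁) (by linear_combination h₂) (by ring)
    -- Euler's relation `4 F = X F_X + Y F_Y + Z F_Z` gives the last partial derivative.
    (by linear_combination 4 * h₁ - x * h₂)
  exact one_ne_zero this.2.2

/-- Otherwise `h`, as a binary form, has a double root at infinity and `(1 : 0 : 0)` is singular. -/
lemma IsSmooth.coeff_ne_zero (hC : IsSmooth (form a b)) : ¬ (b 4 = 0 ∧ b 3 = 0) := by
  rintro ⟨h₁, h₂⟩
  have := hC.eq_zero (u := 1) (v := 0) (w := 0) (fun _ => rfl) (fun _ => rfl)
    (by simp [h₁]) (by simp [h₁]) (by simp) (by simp [h₂])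
  exact one_ne_zero this.1

/-- Over an algebraically closed field of characteristic not 2 we can solve `2 v² = -c`. -/
lemma exists_two_mul_sq (h2 : (2 : k) ≠ 0) (c : AlgebraicClosure k) :
    ∃ v : AlgebraicClosure k, 2 * v ^ 2 = -c := by
  have h2' : (2 : AlgebraicClosure k) ≠ 0 := by
    rw [← map_ofNat (algebraMap k (AlgebraicClosure k)) 2]
    exact (_root_.map_ne_zero _).2 h2
  obtain ⟨v, hv⟩ := IsAlgClosed.exists_pow_nat_eq (-c / 2) two_pos
  exact ⟨v, by rw [hv, mul_div_cancel₀ _ h2']⟩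

/-- With `2 v² = -g(x)`, the point `(x : v : 1)` would be singular. The choice of `v` kills `F_Y`,
and the identity `4 F = (2 y² + g)² - (g² - 4h)` and its derivative in `x` give the rest. -/
lemma IsSmooth.discPoly_no_double_root (hC : IsSmooth (form a b)) (h2 : (2 : k) ≠ 0)
    (x : AlgebraicClosure k) :
    ¬ (aeval x (discPoly a b) = 0 ∧ aeval x (derivative (discPoly a b)) = 0) := by
  have h2' : (2 : AlgebraicClosure k) ≠ 0 := by
    rw [← map_ofNat (algebraMap k (AlgebraicClosure k)) 2]
    exact (_root_.map_ne_zero _).2 h2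
  have h4' : (4 : AlgebraicClosure k) ≠ 0 := by
    rw [show (4 : AlgebraicClosure k) = 2 * 2 by norm_num]
    exact mul_ne_zero h2' h2'
  rintro ⟨h₁, h₂⟩
  obtain ⟨v, hv⟩ := exists_two_mul_sq h2 (aeval x (gPoly a))
  simp only [discPoly, map_sub, map_mul, map_pow, derivative_sq, derivative_mul, derivative_ofNat,
    map_add, map_zero, map_ofNat] at h₁ h₂
  have e₁ : v ^ 4 + aeval x (gPoly a) * v ^ 2 + aeval x (hPoly b) = 0 := by
    refine (mul_eq_zero.1 ?_).resolve_left h4'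
    linear_combination -h₁ + (2 * v ^ 2 + aeval x (gPoly a)) * hv
  have e₂ : aeval x (derivative (gPoly a)) * v ^ 2 + aeval x (derivative (hPoly b)) = 0 := by
    refine (mul_eq_zero.1 ?_).resolve_left h4'
    linear_combination -h₂ + 2 * aeval x (derivative (gPoly a)) * hv
  rw [aeval_hPoly, aeval_gPoly] at e₁
  rw [aeval_derivative_hPoly, aeval_derivative_gPoly] at e₂
  rw [aeval_gPoly] at hv
  have := hC.eq_zero (u := x) (v := v) (w := 1) (fun _ => rfl) (fun _ => rfl)
    (by linear_combination e₁) (by linear_combination e₂) (by linear_combination 2 * v * hv)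
    (by linear_combination 4 * e₁ - x * e₂ - 2 * v ^ 2 * hv)
  exact one_ne_zero this.2.2

/-- The same argument at infinity: the singular point is `(1 : v : 0)` with `2 v² = -a₂`. -/
lemma IsSmooth.discPoly_coeff_ne_zero (hC : IsSmooth (form a b)) (h2 : (2 : k) ≠ 0) :
    ¬ (a 2 ^ 2 - 4 * b 4 = 0 ∧ 2 * a 1 * a 2 - 4 * b 3 = 0) := by
  have h2' : (2 : AlgebraicClosure k) ≠ 0 := by
    rw [← map_ofNat (algebraMap k (AlgebraicClosure k)) 2]
    exact (_root_.map_ne_zero _).2 h2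
  have h4' : (4 : AlgebraicClosure k) ≠ 0 := by
    rw [show (4 : AlgebraicClosure k) = 2 * 2 by norm_num]
    exact mul_ne_zero h2' h2'
  rintro ⟨h₁, h₂⟩
  obtain ⟨v, hv⟩ := exists_two_mul_sq h2 (algebraMap k _ (a 2))
  have h₁ := congrArg (algebraMap k (AlgebraicClosure k)) h₁
  have h₂ := congrArg (algebraMap k (AlgebraicClosure k)) h₂
  simp only [map_sub, map_mul, map_pow, map_ofNat, map_zero] at h₁ h₂
  have := hC.eq_zero (u := 1) (v := v) (w := 0) (fun _ => rfl) (fun _ => rfl)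
    (by
      refine (mul_eq_zero.1 ?_).resolve_left h4'
      linear_combination -h₁ + (2 * v ^ 2 + algebraMap k _ (a 2)) * hv)
    (by linear_combination -h₁ + algebraMap k _ (a 2) * hv)
    (by linear_combination 2 * v * hv)
    (by
      refine (mul_eq_zero.1 ?_).resolve_left h4'
      linear_combination -h₂ + 2 * algebraMap k _ (a 1) * hv)
  exact one_ne_zero this.1

end Smooth

end PlaneQuartic

/-! ### Leading terms and bases in the four cases -/

section Lead

variable {K : Type*} [Field K]

lemma hasLead_quadratic (c₂ c₁ c₀ : K) : HasLead (C c₂ * X ^ 2 + C c₁ * X + C c₀) 2 c₂ :=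
  (HasLead.of_natDegree_le (by compute_degree)).congr (by simp)

lemma hasLead_cubic (c₃ c₂ c₁ c₀ : K) :
    HasLead (C c₃ * X ^ 3 + C c₂ * X ^ 2 + C c₁ * X + C c₀) 3 c₃ :=
  (HasLead.of_natDegree_le (by compute_degree)).congr (by simp)

lemma hasLead_quartic (c₄ c₃ c₂ c₁ c₀ : K) :
    HasLead (C c₄ * X ^ 4 + C c₃ * X ^ 3 + C c₂ * X ^ 2 + C c₁ * X + C c₀) 4 c₄ :=
  (HasLead.of_natDegree_le (by compute_degree)).congr (by simp)

end Lead

section Forms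

variable {K : Type*} [Field K]

lemma PlaneQuartic.hPoly_hasLead {b : Fin 5 → K} :
    HasLead (PlaneQuartic.hPoly b) 4 (b 4) :=
  hasLead_quartic _ _ _ _ _

lemma PlaneQuartic.hPoly_hasLead_of_eq_zero {b : Fin 5 → K} (h : b 4 = 0) :
    HasLead (PlaneQuartic.hPoly b) 3 (b 3) := by
  rw [PlaneQuartic.hPoly, h, C_0, zero_mul, zero_add]
  exact hasLead_cubic _ _ _ _

variable [CharZero K]

lemma classesFormBasis_of_eq_quarticPoly {γ Q : K[X]}
    (hh : IsCoprime (γ ^ 2 - Q) (derivative (γ ^ 2 - Q))) (hQ : IsCoprime Q (derivative Q))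
    {τ e σ : ℕ} (hodd : OddComplement γ Q τ σ) (heven : EvenComplement Q e)
    {S : Finset (ℕ × ℕ)}
    (hS : ∀ j i, (j, i) ∈ S ↔ i = 1 ∧ j < τ ∨ i = 2 ∧ j < e ∨ i = 3 ∧ j < σ)
    {F : K[X][X]} (hF : F = quarticPoly γ Q) :
    DeRham.ClassesFormBasis fun s : S =>
      (AdjoinRoot.of F X ^ s.1.1 * AdjoinRoot.root F ^ s.1.2) •
        KaehlerDifferential.D K (AdjoinRoot F) (AdjoinRoot.of F X) := by
  subst hF
  convert QuarticRing.classesFormBasis_monomialVector hh hQ hodd heven hS using 2 with s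
  rw [QuarticRing.dxForm_apply]
  congr 1
  obtain ⟨⟨j, i⟩, hs⟩ := s
  rcases (hS j i).1 hs with ⟨rfl, -⟩ | ⟨rfl, -⟩ | ⟨rfl, -⟩ <;>
    simp [QuarticRing.comb, monomialVector]

namespace PlaneQuartic

variable (a : Fin 3 → K) (b : Fin 5 → K)

/-- `g / 2`. -/
noncomputable def gammaPoly : K[X] := C (1 / 2) * gPoly a

/-- The quarter of the discriminant `g² - 4 h`. -/
noncomputable def quarterDisc : K[X] := C (1 / 4) * discPoly a b

lemma C_mul_C_inv (n : ℕ) [n.AtLeastTwo] :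
    C (OfNat.ofNat n : K) * C (1 / (OfNat.ofNat n : K)) = 1 := by
  rw [← C_mul, mul_one_div_cancel (OfNat.ofNat_ne_zero n), C_1]

lemma gammaPoly_sq_sub : gammaPoly a ^ 2 - quarterDisc a b = hPoly b := by
  have h2 := C_mul_C_inv (K := K) 2
  have h4 := C_mul_C_inv (K := K) 4
  have : C (1 / 2) ^ 2 = C (1 / 4 : K) := by rw [← C_pow]; norm_num
  rw [gammaPoly, quarterDisc, discPoly, mul_pow, this]
  linear_combination hPoly b * h4

lemma affinePoly_eq_quarticPoly :
    affinePoly a b = quarticPoly (gammaPoly a) (quarterDisc a b) := by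
  have h2 := C_mul_C_inv (K := K) 2
  rw [map_ofNat] at h2
  rw [quarticPoly, gammaPoly_sq_sub, affinePoly_eq, gammaPoly, ← mul_assoc, h2, one_mul]

variable {a b}

lemma gammaPoly_hasLead : HasLead (gammaPoly a) 2 (a 2 / 2) :=
  ((hasLead_quadratic _ _ _).C_mul _).congr (by ring)

lemma quarterDisc_hasLead : HasLead (quarterDisc a b) 4 ((a 2 ^ 2 - 4 * b 4) / 4) := by
  rw [quarterDisc, discPoly_eq]
  exact ((hasLead_quartic _ _ _ _ _).C_mul _).congr (by ring)

lemma quarterDisc_hasLead_of_eq_zero (h : a 2 ^ 2 - 4 * b 4 = 0) :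
    HasLead (quarterDisc a b) 3 ((2 * a 1 * a 2 - 4 * b 3) / 4) := by
  rw [quarterDisc, discPoly_eq, h, C_0, zero_mul, zero_add]
  exact ((hasLead_cubic _ _ _ _).C_mul _).congr (by ring)

/-- The curve is smooth in the affine plane and, over the algebraic closure, at infinity. -/
structure IsNonsingular (a : Fin 3 → K) (b : Fin 5 → K) : Prop where
  coprime_h : IsCoprime (hPoly b) (derivative (hPoly b))
  coprime_disc : IsCoprime (discPoly a b) (derivative (discPoly a b))
  coeff_h : ¬ (b 4 = 0 ∧ b 3 = 0)
  coeff_disc : ¬ (a 2 ^ 2 - 4 * b 4 = 0 ∧ 2 * a 1 * a 2 - 4 * b 3 = 0)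

lemma IsNonsingular.classesFormBasis (H : IsNonsingular a b) {τ e σ : ℕ}
    (hodd : OddComplement (gammaPoly a) (quarterDisc a b) τ σ)
    (heven : EvenComplement (quarterDisc a b) e) {S : Finset (ℕ × ℕ)}
    (hS : ∀ j i, (j, i) ∈ S ↔ i = 1 ∧ j < τ ∨ i = 2 ∧ j < e ∨ i = 3 ∧ j < σ) :
    DeRham.ClassesFormBasis fun s : S => monomialForm a b s.1.1 s.1.2 := by
  refine classesFormBasis_of_eq_quarticPoly ?_ ?_ hodd heven hS (affinePoly_eq_quarticPoly a b)
  · rw [gammaPoly_sq_sub]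
    exact H.coprime_h
  · have hu : IsUnit (C (1 / 4 : K)) := isUnit_C.2 (by norm_num)
    rw [quarterDisc, derivative_C_mul]
    exact (isCoprime_mul_unit_left hu _ _).2 H.coprime_disc

lemma IsNonsingular.one_point (H : IsNonsingular a b) (hb : b 4 = 0) (ha : a 2 = 0) :
    DeRham.ClassesFormBasis fun s : ({(0, 1), (0, 2), (0, 3), (1, 1), (1, 2), (1, 3)} :
      Finset (ℕ × ℕ)) => monomialForm a b s.1.1 s.1.2 := by
  have hb3 : b 3 ≠ 0 := fun h => H.coeff_h ⟨hb, h⟩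
  have hQ := quarterDisc_hasLead_of_eq_zero (a := a) (b := b) (by rw [ha, hb]; ring)
  have hq : (2 * a 1 * a 2 - 4 * b 3) / 4 ≠ 0 := by
    rw [ha]
    simpa using hb3
  refine H.classesFormBasis (oddComplement_of_cubic_cubic (c := a 1 / 2) ?_ hQ ?_ hq hb3)
    (evenComplement_of_hasLead hQ hq) (by
      intro j i
      simp only [Finset.mem_insert, Finset.mem_singleton, Prod.mk.injEq]
      omega)
  · rw [gammaPoly, gPoly, ha, C_0, zero_mul, zero_add]
    have : HasLead (C (a 1) * X + C (a 0)) 1 (a 1) :=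
      (HasLead.of_natDegree_le (by compute_degree)).congr (by simp)
    exact (this.C_mul (1 / 2)).congr (by ring)
  · rw [gammaPoly_sq_sub]
    exact hPoly_hasLead_of_eq_zero hb

lemma IsNonsingular.three_points (H : IsNonsingular a b) (hb : b 4 = 0) (ha : a 2 ≠ 0) :
    DeRham.ClassesFormBasis fun s : ({(0, 1), (0, 2), (0, 3), (1, 1), (1, 2), (1, 3), (2, 2),
      (2, 3)} : Finset (ℕ × ℕ)) => monomialForm a b s.1.1 s.1.2 := by
  have hb3 : b 3 ≠ 0 := fun h => H.coeff_h ⟨hb, h⟩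
  have hQ : HasLead (quarterDisc a b) 4 ((a 2 / 2) ^ 2) :=
    quarterDisc_hasLead.congr (by rw [hb]; ring)
  have hc : a 2 / 2 ≠ 0 := div_ne_zero ha two_ne_zero
  refine H.classesFormBasis (oddComplement_of_quartic_cubic gammaPoly_hasLead hQ ?_ hb3 hc)
    (evenComplement_of_hasLead hQ (pow_ne_zero 2 hc)) (by
      intro j i
      simp only [Finset.mem_insert, Finset.mem_singleton, Prod.mk.injEq]
      omega)
  rw [gammaPoly_sq_sub]
  exact hPoly_hasLead_of_eq_zero hb

lemma IsNonsingular.two_points (H : IsNonsingular a b) (hb : b 4 ≠ 0)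
    (hd : a 2 ^ 2 - 4 * b 4 = 0) :
    DeRham.ClassesFormBasis fun s : ({(0, 1), (0, 2), (0, 3), (1, 1), (1, 2), (1, 3),
      (2, 1)} : Finset (ℕ × ℕ)) => monomialForm a b s.1.1 s.1.2 := by
  have hQ := quarterDisc_hasLead_of_eq_zero hd
  have hq : (2 * a 1 * a 2 - 4 * b 3) / 4 ≠ 0 :=
    div_ne_zero (fun h => H.coeff_disc ⟨hd, h⟩) (OfNat.ofNat_ne_zero 4)
  -- If `a₂` vanished, the relation `a₂² = 4 b₄` would give `b₄ = 0`.
  have hc : a 2 / 2 ≠ 0 := by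
    refine div_ne_zero (fun h => hb ?_) two_ne_zero
    rw [h] at hd
    simpa using hd
  refine H.classesFormBasis (oddComplement_of_cubic_quartic gammaPoly_hasLead hQ ?_ hq hc)
    (evenComplement_of_hasLead hQ hq) (by
      intro j i
      simp only [Finset.mem_insert, Finset.mem_singleton, Prod.mk.injEq]
      omega)
  rw [gammaPoly_sq_sub]
  exact hPoly_hasLead.congr (by linear_combination -hd / 4)

lemma IsNonsingular.four_points (H : IsNonsingular a b) (hb : b 4 ≠ 0)
    (hd : a 2 ^ 2 - 4 * b 4 ≠ 0) :
    DeRham.ClassesFormBasis fun s : ({(0, 1), (0, 2), (0, 3), (1, 1), (1, 2), (1, 3), (2, 1),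
      (2, 2), (2, 3)} : Finset (ℕ × ℕ)) => monomialForm a b s.1.1 s.1.2 := by
  have hq : (a 2 ^ 2 - 4 * b 4) / 4 ≠ 0 := div_ne_zero hd (OfNat.ofNat_ne_zero 4)
  refine H.classesFormBasis
    (oddComplement_of_quartic_quartic gammaPoly_hasLead quarterDisc_hasLead ?_ hq hb)
    (evenComplement_of_hasLead quarterDisc_hasLead hq) (by
      intro j i
      simp only [Finset.mem_insert, Finset.mem_singleton, Prod.mk.injEq]
      omega)
  rw [gammaPoly_sq_sub]
  exact hPoly_hasLead

end PlaneQuartic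

end Forms

/-! ### Passage from the residue field to `ℚ_q` -/

section Witt

open PlaneQuartic

variable {p : ℕ} [Fact p.Prime] {k : Type*} [Field k] [CharP k p]

/-- A prime characteristic would also be zero in `k`, hence equal to `p`, but `p` is not zero in the
Witt vectors. -/
lemma Zq.charZero [Finite k] : CharZero (Zq p k) := by
  obtain ⟨q, hq⟩ := CharP.exists (Zq p k)
  rcases CharP.char_is_prime_or_zero (Zq p k) q with h | rfl
  · have hk : (q : k) = 0 := by
      have := congrArg WittVector.constantCoeff (CharP.cast_eq_zero (Zq p k) q)
      rwa [map_natCast, map_zero] at this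
    obtain rfl : p = q :=
      (Nat.prime_dvd_prime_iff_eq Fact.out h).1 ((CharP.cast_eq_zero_iff k p q).1 hk)
    exact absurd (CharP.cast_eq_zero (Zq p k) p) (WittVector.p_nonzero p k)
  · exact CharP.charP_to_charZero _

lemma Qq.charZero [Finite k] : CharZero (Qq p k) :=
  haveI := Zq.charZero (p := p) (k := k)
  charZero_of_injective_algebraMap (IsFractionRing.injective (Zq p k) (Qq p k))

/-- Each condition holds for the reduction by smoothness and lifts: separability through Gauss's
lemma, nonvanishing because an element that is zero in `ℚ_q` reduces to zero. Oddness of `p` is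
needed to solve `2 v² = -g` in the residue field. -/
lemma isNonsingular_generic [Finite k] (hp : p ≠ 2) {a : Fin 3 → Zq p k} {b : Fin 5 → Zq p k}
    (hC : IsSmooth (form (reduction a) (reduction b))) :
    IsNonsingular (generic a) (generic b) := by
  have := Qq.charZero (p := p) (k := k)
  have h2 : (2 : k) ≠ 0 := by
    intro h
    have h' : ((2 : ℕ) : k) = 0 := by exact_mod_cast h
    exact hp ((Nat.prime_dvd_prime_iff_eq Fact.out Nat.prime_two).1
      ((CharP.cast_eq_zero_iff k p 2).1 h'))
  have hinj : Function.Injective (algebraMap (Zq p k) (Qq p k)) := IsFractionRing.injective _ _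
  have hred : ∀ x : Zq p k, algebraMap (Zq p k) (Qq p k) x = 0 →
      WittVector.constantCoeff x = 0 := fun x hx => by
    rw [(map_eq_zero_iff _ hinj).1 hx, map_zero]
  have hcoprime : IsCoprime (hPoly (generic b)) (derivative (hPoly (generic b))) := by
    have := isCoprime_derivative_of_reduction (K := Qq p k)
      (WittVector.constantCoeff : WittVector p k →+* k) (f := hPoly b)
      (by unfold hPoly; compute_degree)
      (by
        rw [show (hPoly b).coeff 4 = b 4 by simp [hPoly],
          show (hPoly b).coeff 3 = b 3 by simp [hPoly]]
        exact hC.coeff_ne_zero)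
      (by
        rw [hPoly_map]
        exact hC.hPoly_no_double_root)
    rwa [hPoly_map] at this
  have hcoprime' : IsCoprime (discPoly (generic a) (generic b))
      (derivative (discPoly (generic a) (generic b))) := by
    have := isCoprime_derivative_of_reduction (K := Qq p k)
      (WittVector.constantCoeff : WittVector p k →+* k) (f := discPoly a b)
      (by rw [discPoly_eq]; compute_degree)
      (by
        rw [discPoly_coeff_four, discPoly_coeff_three]
        simp only [map_sub, map_mul, map_pow, map_ofNat]
        exact hC.discPoly_coeff_ne_zero h2)
      (by
        rw [discPoly_map]
        exact hC.discPoly_no_double_root h2)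
    rwa [discPoly_map] at this
  refine ⟨hcoprime, hcoprime', fun h => hC.coeff_ne_zero ⟨hred _ h.1, hred _ h.2⟩,
    fun h => hC.discPoly_coeff_ne_zero h2 ?_⟩
  have h₁ := hred (a 2 ^ 2 - 4 * b 4) (by
    rw [← h.1]
    simp only [generic, map_sub, map_mul, map_pow, map_ofNat])
  have h₂ := hred (2 * a 1 * a 2 - 4 * b 3) (by
    rw [← h.2]
    simp only [generic, map_sub, map_mul, map_ofNat])
  simp only [map_sub, map_mul, map_pow, map_ofNat] at h₁ h₂
  exact ⟨h₁, h₂⟩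

/-- The dimension is the number of elements of a basis. -/
lemma dimH1_eq_card [Finite k] {a : Fin 3 → Zq p k} {b : Fin 5 → Zq p k} {S : Finset (ℕ × ℕ)}
    (h : IsH1Basis a b S) : dimH1 a b = S.card := by
  obtain ⟨B, -⟩ := h
  rw [dimH1, Module.finrank_eq_card_basis B, Fintype.card_coe]

end Witt

theorem proposition1 (p : ℕ) [Fact p.Prime] (hp : p ≠ 2)
    (k : Type*) [Field k] [Finite k] [CharP k p]
    (a : Fin 3 → Zq p k) (b : Fin 5 → Zq p k)
    (hC : PlaneQuartic.IsSmooth (PlaneQuartic.form (reduction a) (reduction b))) :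
    (b 4 = 0 → a 2 = 0 →
      IsH1Basis a b {(0, 1), (0, 2), (0, 3), (1, 1), (1, 2), (1, 3)} ∧ dimH1 a b = 6) ∧
    (b 4 = 0 → a 2 ≠ 0 →
      IsH1Basis a b {(0, 1), (0, 2), (0, 3), (1, 1), (1, 2), (1, 3), (2, 2), (2, 3)} ∧
        dimH1 a b = 8) ∧
    (b 4 ≠ 0 → a 2 ^ 2 - 4 * b 4 = 0 →
      IsH1Basis a b {(0, 1), (0, 2), (0, 3), (1, 1), (1, 2), (1, 3), (2, 1)} ∧
        dimH1 a b = 7) ∧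
    (b 4 ≠ 0 → a 2 ^ 2 - 4 * b 4 ≠ 0 →
      IsH1Basis a b {(0, 1), (0, 2), (0, 3), (1, 1), (1, 2), (1, 3), (2, 1), (2, 2), (2, 3)} ∧
        dimH1 a b = 9) := by
  have := Qq.charZero (p := p) (k := k)
  have H := isNonsingular_generic hp hC
  have hinj : Function.Injective (algebraMap (Zq p k) (Qq p k)) := IsFractionRing.injective _ _
  have h0 (x : Zq p k) : algebraMap (Zq p k) (Qq p k) x = 0 ↔ x = 0 := map_eq_zero_iff _ hinj
  have hd : generic a 2 ^ 2 - 4 * generic b 4 = 0 ↔ a 2 ^ 2 - 4 * b 4 = 0 := by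
    rw [← h0]
    simp only [generic, map_sub, map_mul, map_pow, map_ofNat]
  refine ⟨fun hb ha => ?_, fun hb ha => ?_, fun hb h => ?_, fun hb h => ?_⟩
  · have := H.one_point ((h0 _).2 hb) ((h0 _).2 ha)
    exact ⟨this, dimH1_eq_card this⟩
  · have := H.three_points ((h0 _).2 hb) ((h0 _).not.2 ha)
    exact ⟨this, dimH1_eq_card this⟩
  · have := H.two_points ((h0 _).not.2 hb) (hd.2 h)
    exact ⟨this, dimH1_eq_card this⟩
  · have := H.four_points ((h0 _).not.2 hb) (hd.not.2 h)
    exact ⟨this, dimH1_eq_card this⟩
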